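/- All graphs are simple. A hole of a graph $G$ is an induced cycle of $G$ of length at least $4$. A hole cover of $G$ is a nonempty set of vertices of $G$ that contains at least one vertex of every hole of $G$. A vertex $u$ of $G$ satisfies the NC (non-consecutive) property if no hole containing $u$ and no hole not containing $u$ have two consecutive edges (two distinct edges with a common end) in common. A graph $G$ satisfies the NC property if it has a hole cover $\mathcal{C}$ such that every vertex of $\mathcal{C}$ satisfies the NC property and every hole of $G$ contains at most one vertex of $\mathcal{C}$. A $k$-correspondence assignment for $G$ assigns to every edge $uv$ of $G$ a (possibly empty, not necessarily perfect) matching $M_{uv}$ between $\{u\}\times\{1,\dots,k\}$ and $\{v\}\times\{1,\dots,k\}$; a colouring for it is a function $f\colon V(G)\to\{1,\dots,k\}$ such that $(u,f(u))(v,f(v))\notin M_{uv}$ for every edge $uv$ of $G$. The DP-chromatic number $\chi_{DP}(G)$ is the least $k$ such that every $k$-correspondence assignment for $G$ has a colouring. **Theorem.** Let $k$ be a positive integer, and let $G$ be a graph that satisfies the NC property and is the union of $k$ pairwise edge-disjoint copies of the complete graph $K_k$. Then $\chi_{DP}(G)=k$. In particular, the Erdős–Faber–Lovász statement $\chi(G)=k$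 holds for $G$. -/

import Mathlib

namespace SimpleGraph

/-- `H` is a hole of `G`: an induced cycle of length at least four. -/
def IsHole {V : Type*} (G : SimpleGraph V) (H : G.Subgraph) : Prop :=
  H.IsInduced ∧ ∃ n : ℕ, 4 ≤ n ∧ Nonempty (H.coe ≃g cycleGraph n)

/-- A hole cover of `G`: a nonempty set of vertices that meets every hole of `G`. -/
def IsHoleCover {V : Type*} (G : SimpleGraph V) (C : Set V) : Prop :=
  C.Nonempty ∧ ∀ H : G.Subgraph, G.IsHole H → (H.verts ∩ C).Nonempty

/-- Two subgraphs share consecutive edges: two distinct edges `ab`, `bc` with a common end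
belong to both. -/
def ShareConsecutiveEdges {V : Type*} {G : SimpleGraph V} (H H' : G.Subgraph) : Prop :=
  ∃ a b c : V, a ≠ c ∧ H.Adj a b ∧ H.Adj b c ∧ H'.Adj a b ∧ H'.Adj b c

/-- The non-consecutive property of a vertex `u`: a hole that contains `u` and a hole that does
not contain `u` never share consecutive edges. -/
def VertexNC {V : Type*} (G : SimpleGraph V) (u : V) : Prop :=
  ∀ H H' : G.Subgraph, G.IsHole H → G.IsHole H' → u ∈ H.verts → u ∉ H'.verts →
    ¬ ShareConsecutiveEdges H H'

/-- The NC property of a set of vertices: each of its vertices has the NC property, and every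
hole contains at most one of its vertices. -/
def SetNC {V : Type*} (G : SimpleGraph V) (C : Set V) : Prop :=
  (∀ u ∈ C, G.VertexNC u) ∧ ∀ H : G.Subgraph, G.IsHole H → (H.verts ∩ C).Subsingleton

/-- The NC property of a graph. -/
def HasNC {V : Type*} (G : SimpleGraph V) : Prop :=
  ∃ C : Set V, G.IsHoleCover C ∧ G.SetNC C

/-- A `k`-correspondence assignment for `G`: for each edge `uv`, a partial matching between
`{u} × [k]` and `{v} × [k]`. Here `rel u v a b` says that `(u, a)` is matched with `(v, b)`;
by the symmetry, `unique` gives uniqueness of partners on both sides. Values of `rel u v` for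
nonadjacent `u`, `v` play no role. -/
structure CorrespondenceAssignment {V : Type*} (G : SimpleGraph V) (k : ℕ) where
  rel : V → V → Fin k → Fin k → Prop
  symm : ∀ u v : V, G.Adj u v → ∀ a b : Fin k, rel u v a b → rel v u b a
  unique : ∀ u v : V, G.Adj u v → ∀ a b b' : Fin k, rel u v a b → rel u v a b' → b = b'

/-- `f` is a colouring for the correspondence assignment: no edge `uv` has `(u, f u)` matched
with `(v, f v)`. -/
def CorrespondenceAssignment.IsColoring {V : Type*} {G : SimpleGraph V} {k : ℕ}
    (M : G.CorrespondenceAssignment k) (f : V → Fin k) : Prop :=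
  ∀ u v : V, G.Adj u v → ¬ M.rel u v (f u) (f v)

/-- `G` is DP-`k`-colourable: every `k`-correspondence assignment has a colouring. -/
def DPColorable {V : Type*} (G : SimpleGraph V) (k : ℕ) : Prop :=
  ∀ M : G.CorrespondenceAssignment k, ∃ f : V → Fin k, M.IsColoring f

/-- The DP-chromatic number (correspondence chromatic number): the least `k` such that `G` is
DP-`k`-colourable, and `⊤` if there is none. -/
noncomputable def dpChromaticNumber {V : Type*} (G : SimpleGraph V) : ℕ∞ :=
  ⨅ n ∈ {n : ℕ | G.DPColorable n}, (n : ℕ∞)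

end SimpleGraph

/-!
Holes are handled through their vertex sets (`IsHoleSet`), and all connectivity arguments take place
inside sets of vertices. The basic construction is `exists_isHoleSet`: two disjoint connected sets
without edges between them, both attached to each of two nonadjacent vertices, contain the two arcs
of a hole through these vertices.

Let `C` be a hole cover as in the NC property. The properties used are collected in `IsNCCover`;
they pass to induced subgraphs. The proof rests on an analogue of Dirac's theorem on simplicial
vertices of chordal graphs (`IsNCCover.exists_isNearSimplicial_aux`): if `G` is not complete, then
it has two nonadjacent vertices whose neighbourhoods become cliques after the removal of at most one
vertex of `C`. As in Dirac's argument, a clique cutset splits `G` into smaller graphs. A graph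
without clique cutsets is complete if it has no holes. Otherwise some `u ∈ C` lies on a hole, hence
on all holes (`IsNCCover.mem_of_mem`), so that `G - u` is chordal.

For `IsNCCover.mem_of_mem`, suppose that a hole `H` avoids `u`. If a connected set through `u` is
attached to `H` in a non-clique, while its connected parts avoiding `u` are attached in cliques,
then `u` is adjacent to all of `H` (`IsNCCover.adj_of_att`): otherwise a hole through `u` would
share an arc with `H`, or `H` would be a four-cycle whose vertex in `C` shares a hole with `u`. It
follows that if `u` has neighbours on both sides of a separating set `T` that is not a clique, and
all vertices of `T` are attached to both sides, then `T` lies in the neighbourhood of `u`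
(`IsNCCover.adj_of_twoSided`). This is applied to separations of vertices of the core of `H`, the
set of vertices that no clique separates from `H` in `G - u`. In the absence of clique cutsets, `u`
turns out to be adjacent to the whole core (`IsNCCover.adj_of_mem_core`), and then to all other
vertices of `G`, which is absurd for a vertex of a hole.

Now let `G` be the edge-disjoint union of `k` cliques on `k` vertices. It is coloured greedily:
every nonempty set `s` of vertices contains a vertex with fewer than `k` neighbours in `s`. This is
clear if some vertex of `s` is on one of the `k` cliques only. Otherwise, if the cliques inside `s`
have fewer than `k` vertices, then a nearly simplicial vertex of `s` will do. If `s` contains a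
clique on `k` vertices, then the case of equality in the de Bruijn–Erdős theorem shows that this
clique is all of `s` (`IsCliqueDecomposition.mem_of_isClique`).
-/

namespace SimpleGraph

section SetConnectivity

variable {V : Type*} {G : SimpleGraph V}

/-! ### Connectivity inside a set of vertices -/

/-- `x` and `y` are joined by a walk of `G` all of whose edges have both ends in `s`.
The relation is reflexive also at vertices outside `s`. -/
def LinkedIn (G : SimpleGraph V) (s : Set V) (x y : V) : Prop :=
  Relation.ReflTransGen (fun a b => G.Adj a b ∧ a ∈ s ∧ b ∈ s) x y

/-- The induced subgraph on `s` is preconnected (the empty set is allowed). -/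
def SetConn (G : SimpleGraph V) (s : Set V) : Prop :=
  ∀ x ∈ s, ∀ y ∈ s, G.LinkedIn s x y

/-- The component of `x` in the induced subgraph on `s`. -/
def compIn (G : SimpleGraph V) (s : Set V) (x : V) : Set V :=
  {y | y ∈ s ∧ G.LinkedIn s x y}

/-- The vertices of `H` that have a neighbour in `Z`. -/
def att (G : SimpleGraph V) (H Z : Set V) : Set V :=
  {h | h ∈ H ∧ ∃ z ∈ Z, G.Adj z h}

theorem LinkedIn.symm {s : Set V} {x y : V} (h : G.LinkedIn s x y) : G.LinkedIn s y x := by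
  induction h with
  | refl => exact .refl
  | tail _ hbc ih => exact .head ⟨hbc.1.symm, hbc.2.2, hbc.2.1⟩ ih

theorem LinkedIn.trans {s : Set V} {x y z : V} (h : G.LinkedIn s x y) (h' : G.LinkedIn s y z) :
    G.LinkedIn s x z :=
  Relation.ReflTransGen.trans h h'

theorem LinkedIn.mono {s t : Set V} (hst : s ⊆ t) {x y : V} (h : G.LinkedIn s x y) :
    G.LinkedIn t x y :=
  Relation.ReflTransGen.mono (fun _ _ hab => ⟨hab.1, hst hab.2.1, hst hab.2.2⟩) _ _ h

theorem Adj.linkedIn {s : Set V} {x y : V} (h : G.Adj x y) (hx : x ∈ s) (hy : y ∈ s) :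
    G.LinkedIn s x y :=
  .single ⟨h, hx, hy⟩

/-- A set that is closed under adjacency inside `s` is not left by a walk inside `s`. -/
theorem LinkedIn.mem_of_closed {s U : Set V} {x y : V} (h : G.LinkedIn s x y) (hx : x ∈ U)
    (hU : ∀ a ∈ U, a ∈ s → ∀ b ∈ s, G.Adj a b → b ∈ U) : y ∈ U := by
  induction h with
  | refl => exact hx
  | tail _ hbc ih => exact hU _ ih hbc.2.1 _ hbc.2.2 hbc.1

theorem LinkedIn.mem {s : Set V} {x y : V} (h : G.LinkedIn s x y) (hx : x ∈ s) : y ∈ s :=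
  h.mem_of_closed hx fun _ _ _ _ hb _ => hb

/-- A connected set that meets both `U` and its complement has an edge across. -/
theorem SetConn.exists_adj_boundary {s U : Set V} (hs : G.SetConn s) {x y : V} (hx : x ∈ s)
    (hxU : x ∈ U) (hy : y ∈ s) (hyU : y ∉ U) :
    ∃ a ∈ s, a ∈ U ∧ ∃ b ∈ s, b ∉ U ∧ G.Adj a b := by
  by_contra! hcon
  refine hyU ((hs x hx y hy).mem_of_closed hxU fun a haU has b hb hab => ?_)
  by_contra hbU
  exact hcon a has haU b hb hbU hab

theorem mem_compIn_self {s : Set V} {x : V} (hx : x ∈ s) : x ∈ G.compIn s x :=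
  ⟨hx, .refl⟩

theorem compIn_subset {s : Set V} {x : V} : G.compIn s x ⊆ s := fun _ h => h.1

theorem compIn_closed {s : Set V} {x a b : V} (ha : a ∈ G.compIn s x) (hb : b ∈ s)
    (hab : G.Adj a b) : b ∈ G.compIn s x :=
  ⟨hb, ha.2.trans (hab.linkedIn ha.1 hb)⟩

theorem LinkedIn.compIn {s : Set V} {x y : V} (h : G.LinkedIn s x y) :
    G.LinkedIn (G.compIn s x) x y := by
  induction h with
  | refl => exact .refl
  | @tail b c hb hbc ih =>
    exact ih.trans (hbc.1.linkedIn ⟨hbc.2.1, hb⟩ ⟨hbc.2.2, hb.tail hbc⟩)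

theorem setConn_compIn {s : Set V} {x : V} : G.SetConn (G.compIn s x) :=
  fun _ ha _ hb => ha.2.compIn.symm.trans hb.2.compIn

theorem SetConn.subset_compIn {s t : Set V} (ht : G.SetConn t) (hts : t ⊆ s) {x y : V}
    (hy : y ∈ t) (hyx : y ∈ G.compIn s x) : t ⊆ G.compIn s x :=
  fun z hz => ⟨hts hz, hyx.2.trans ((ht y hy z hz).mono hts)⟩

theorem setConn_singleton (x : V) : G.SetConn {x} := by
  rintro a rfl b rfl
  exact .refl

theorem SetConn.union {s t : Set V} (hs : G.SetConn s) (ht : G.SetConn t) {a b : V} (ha : a ∈ s)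
    (hb : b ∈ t) (hab : G.Adj a b) : G.SetConn (s ∪ t) := by
  have key : ∀ y ∈ s ∪ t, G.LinkedIn (s ∪ t) a y := by
    rintro y (hy | hy)
    · exact (hs a ha y hy).mono Set.subset_union_left
    · exact (hab.linkedIn (Or.inl ha) (Or.inr hb)).trans
        ((ht b hb y hy).mono Set.subset_union_right)
  exact fun x hx y hy => (key x hx).symm.trans (key y hy)

theorem SetConn.insert_adj {s : Set V} (hs : G.SetConn s) {a x : V} (ha : a ∈ s) (hax : G.Adj a x) :
    G.SetConn (insert x s) := by
  rw [← Set.union_singleton]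
  exact hs.union (setConn_singleton x) ha rfl hax

theorem not_isClique_iff_exists {s : Set V} :
    ¬ G.IsClique s ↔ ∃ x ∈ s, ∃ y ∈ s, x ≠ y ∧ ¬ G.Adj x y := by
  simp [IsClique, Set.Pairwise]

/-- A connected set with at least two vertices is obtained from a smaller nonempty connected set
by adding one vertex. -/
theorem SetConn.exists_diff_singleton [Finite V] {Z : Set V} (hZ : G.SetConn Z) {x y : V}
    (hx : x ∈ Z) (hy : y ∈ Z) (hxy : x ≠ y) :
    ∃ z ∈ Z, (Z \ {z}).Nonempty ∧ G.SetConn (Z \ {z}) := by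
  obtain ⟨W, hxW, hW⟩ := (Set.toFinite {W : Set V | W ⊆ Z ∧ W ≠ Z ∧ G.SetConn W}).exists_le_maximal
    (a := {x}) ⟨by simpa using hx, fun h => hxy (by rw [← h] at hy; exact hy.symm),
      setConn_singleton x⟩
  obtain ⟨hWZ, hne, hWc⟩ := hW.prop
  have hxW : x ∈ W := hxW rfl
  obtain ⟨w, hwZ, hwW⟩ := Set.exists_of_ssubset (hWZ.ssubset_of_ne hne)
  obtain ⟨a, -, haW, b, hbZ, hbW, hab⟩ := hZ.exists_adj_boundary hx hxW hwZ hwW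
  have hins : insert b W = Z := by
    by_contra hne'
    exact hbW (hW.le_of_ge ⟨Set.insert_subset hbZ hWZ, hne', hWc.insert_adj haW hab⟩
      (Set.subset_insert b W) (Set.mem_insert b W))
  have hdiff : Z \ {b} = W := by
    rw [← hins]
    exact Set.insert_sdiff_self_of_notMem hbW
  exact ⟨b, hbZ, hdiff ▸ ⟨x, hxW⟩, hdiff ▸ hWc⟩

end SetConnectivity

section HoleSets

variable {V : Type*} {G : SimpleGraph V}

/-! ### Vertex sets of holes -/

/-- `f 0, …, f (n - 1)` are distinct vertices whose adjacencies are exactly those of consecutive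
terms, in the cyclic order. -/
def IsCycleRep (G : SimpleGraph V) (n : ℕ) (f : ℕ → V) : Prop :=
  ∀ i j, i < j → j < n → f i ≠ f j ∧ (G.Adj (f i) (f j) ↔ j = i + 1 ∨ (i = 0 ∧ j + 1 = n))

/-- `s` is the vertex set of a hole of `G`. As holes are induced, `s` determines the hole. -/
def IsHoleSet (G : SimpleGraph V) (s : Set V) : Prop :=
  ∃ n f, 4 ≤ n ∧ G.IsCycleRep n f ∧ s = f '' Set.Iio n

theorem IsCycleRep.rotate {n : ℕ} {f : ℕ → V} (h : G.IsCycleRep n f) {m : ℕ} (hm : m < n) :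
    G.IsCycleRep n (fun i => f (if i + m < n then i + m else i + m - n)) := by
  intro i j hij hj
  dsimp only
  split_ifs with h1 h2 h2
  · have := h (i + m) (j + m) (by omega) h2
    refine ⟨this.1, this.2.trans ?_⟩
    omega
  · have := h (j + m - n) (i + m) (by omega) h1
    refine ⟨this.1.symm, (G.adj_comm _ _).trans (this.2.trans ?_)⟩
    omega
  · omega
  · have := h (i + m - n) (j + m - n) (by omega) (by omega)
    refine ⟨this.1, this.2.trans ?_⟩
    omega

/-- The cyclic enumeration of a hole may start at any of its vertices. -/
theorem IsHoleSet.exists_rep {s : Set V} (hs : G.IsHoleSet s) {c : V} (hc : c ∈ s) :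
    ∃ n f, 4 ≤ n ∧ G.IsCycleRep n f ∧ s = f '' Set.Iio n ∧ f 0 = c := by
  obtain ⟨n, f, hn, hf, rfl⟩ := hs
  obtain ⟨m, hm, rfl⟩ := hc
  have hm : m < n := hm
  refine ⟨n, _, hn, hf.rotate hm, ?_, ?_⟩
  · ext x
    constructor
    · rintro ⟨i, hi, rfl⟩
      have hi : i < n := hi
      refine ⟨if m ≤ i then i - m else i + n - m, ?_, ?_⟩
      · simp only [Set.mem_Iio]
        split_ifs <;> omega
      · dsimp only
        congr 1
        split_ifs <;> omega
    · rintro ⟨i, hi, rfl⟩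
      have hi : i < n := hi
      refine ⟨_, ?_, rfl⟩
      simp only [Set.mem_Iio]
      split_ifs <;> omega
  · simp [hm]

theorem IsCycleRep.setConn_image_Ico {n : ℕ} {f : ℕ → V} (h : G.IsCycleRep n f) (a : ℕ) {b : ℕ}
    (hb : b ≤ n) : G.SetConn (f '' Set.Ico a b) := by
  induction b with
  | zero => simp [SetConn]
  | succ b ih =>
    rcases lt_trichotomy a b with hab | rfl | hab
    · have : f '' Set.Ico a (b + 1) = insert (f b) (f '' Set.Ico a b) := by
        rw [← Set.image_insert_eq, Set.insert_Ico_right_eq_Ico_add_one hab.le]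
      rw [this]
      refine (ih (by omega)).insert_adj (a := f (b - 1)) ⟨b - 1, ?_, rfl⟩ ?_
      · simp only [Set.mem_Ico]; omega
      · exact (h (b - 1) b (by omega) (by omega)).2.2 (by omega)
    · rw [Set.Ico_add_one_right_eq_Icc, Set.Icc_self, Set.image_singleton]
      exact setConn_singleton (f a)
    · rw [Set.Ico_eq_empty (by omega)]
      simp [SetConn]

theorem IsCycleRep.eq_of_eq {n : ℕ} {f : ℕ → V} (h : G.IsCycleRep n f) {i j : ℕ} (hi : i < n)
    (hj : j < n) (hij : f i = f j) : i = j := by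
  rcases lt_trichotomy i j with h1 | h1 | h1
  · exact absurd hij (h i j h1 hj).1
  · exact h1
  · exact absurd hij.symm (h j i h1 hi).1

theorem IsCycleRep.adj_iff {n : ℕ} {f : ℕ → V} (h : G.IsCycleRep n f) {i j : ℕ} (hi : i < n)
    (hj : j < n) : G.Adj (f i) (f j) ↔
      j = i + 1 ∨ i = j + 1 ∨ (i = 0 ∧ j + 1 = n ∧ i < j) ∨ (j = 0 ∧ i + 1 = n ∧ j < i) := by
  rcases lt_trichotomy i j with h1 | rfl | h1
  · rw [(h i j h1 hj).2]; omega
  · simp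
  · rw [G.adj_comm, (h j i h1 hi).2]; omega

theorem IsHoleSet.exists_not_adj {s : Set V} (hs : G.IsHoleSet s) {w : V} (hw : w ∈ s) :
    ∃ y ∈ s, w ≠ y ∧ ¬ G.Adj w y := by
  obtain ⟨n, f, hn, hf, rfl, rfl⟩ := hs.exists_rep hw
  have := hf 0 2 (by omega) (by omega)
  refine ⟨f 2, ⟨2, by simp only [Set.mem_Iio]; omega, rfl⟩, this.1, ?_⟩
  rw [this.2]
  omega

theorem IsHoleSet.not_isClique {s : Set V} (hs : G.IsHoleSet s) : ¬ G.IsClique s := by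
  have hne : s.Nonempty := by
    obtain ⟨n, f, hn, -, rfl⟩ := hs
    exact ⟨f 0, 0, by simp only [Set.mem_Iio]; omega, rfl⟩
  obtain ⟨w, hw⟩ := hne
  obtain ⟨y, hy, hwy, hadj⟩ := hs.exists_not_adj hw
  exact fun h => hadj (h hw hy hwy)

/-- A hole has no clique cutset. -/
theorem IsHoleSet.setConn_diff {s K : Set V} (hs : G.IsHoleSet s) (hK : G.IsClique K) :
    G.SetConn (s \ K) := by
  by_cases h0 : ∃ c ∈ s, c ∈ K
  · obtain ⟨c, hcs, hcK⟩ := h0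
    obtain ⟨n, f, hn, hf, rfl, rfl⟩ := hs.exists_rep hcs
    have key : ∀ i, 0 < i → i < n → f i ∈ K → i = 1 ∨ i + 1 = n := by
      intro i hi hin hiK
      have h1 := hf 0 i hi hin
      have := h1.2.1 (hK hcK hiK h1.1)
      omega
    have key2 : f 1 ∈ K → f (n - 1) ∉ K := by
      intro h1 h2
      have h3 := hf 1 (n - 1) (by omega) (by omega)
      have := h3.2.1 (hK h1 h2 h3.1)
      omega
    have eq_of : ∀ a b, a ≤ b → b ≤ n → (∀ i < n, f i ∉ K ↔ a ≤ i ∧ i < b) →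
        (f '' Set.Iio n) \ K = f '' Set.Ico a b := by
      intro a b hab hb hiff
      ext x
      constructor
      · rintro ⟨⟨i, hi, rfl⟩, hxK⟩
        exact ⟨i, (hiff i hi).1 hxK, rfl⟩
      · rintro ⟨i, hi, rfl⟩
        have hin : i < n := lt_of_lt_of_le hi.2 hb
        exact ⟨⟨i, hin, rfl⟩, (hiff i hin).2 hi⟩
    by_cases h1 : f 1 ∈ K
    · rw [eq_of 2 n (by omega) le_rfl]
      · exact hf.setConn_image_Ico 2 le_rfl
      · intro i hi
        constructor
        · intro hiK
          refine ⟨?_, hi⟩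
          by_contra hlt
          have : i = 0 ∨ i = 1 := by omega
          rcases this with rfl | rfl
          · exact hiK hcK
          · exact hiK h1
        · rintro ⟨h2, -⟩ hiK
          rcases key i (by omega) hi hiK with h3 | h3
          · omega
          · exact key2 h1 (by rwa [show n - 1 = i by omega])
    · by_cases h2 : f (n - 1) ∈ K
      · rw [eq_of 1 (n - 1) (by omega) (by omega)]
        · exact hf.setConn_image_Ico 1 (by omega)
        · intro i hi
          constructor
          · intro hiK
            by_contra hlt
            have : i = 0 ∨ i = n - 1 := by omega
            rcases this with rfl | rfl
            · exact hiK hcK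
            · exact hiK h2
          · rintro ⟨h3, h4⟩ hiK
            rcases key i (by omega) hi hiK with rfl | h5
            · exact h1 hiK
            · omega
      · rw [eq_of 1 n (by omega) le_rfl]
        · exact hf.setConn_image_Ico 1 le_rfl
        · intro i hi
          constructor
          · intro hiK
            refine ⟨?_, hi⟩
            by_contra hlt
            have : i = 0 := by omega
            subst this
            exact hiK hcK
          · rintro ⟨h3, -⟩ hiK
            rcases key i (by omega) hi hiK with rfl | h5
            · exact h1 hiK
            · exact h2 (by rwa [show n - 1 = i by omega])
  · push Not at h0
    have : s \ K = s := by
      ext x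
      exact ⟨fun h => h.1, fun h => ⟨h, h0 x h⟩⟩
    rw [this]
    obtain ⟨n, f, hn, hf, rfl⟩ := hs
    have hI : Set.Iio n = Set.Ico 0 n := by ext; simp
    rw [hI]
    exact hf.setConn_image_Ico 0 le_rfl

/-- Two nonadjacent vertices of a hole cut it into two arcs. -/
theorem IsHoleSet.exists_arcs {s : Set V} (hs : G.IsHoleSet s) {c d : V} (hc : c ∈ s) (hd : d ∈ s)
    (hcd : c ≠ d) (hadj : ¬ G.Adj c d) :
    ∃ I J : Set V, G.SetConn I ∧ G.SetConn J ∧ I ∪ J = s \ {c, d} ∧ Disjoint I J ∧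
      (∀ x ∈ I, ∀ y ∈ J, ¬ G.Adj x y) ∧ (∃ x ∈ I, G.Adj c x) ∧ (∃ x ∈ I, G.Adj d x) ∧
      (∃ x ∈ J, G.Adj c x) ∧ (∃ x ∈ J, G.Adj d x) := by
  obtain ⟨n, f, hn, hf, rfl, rfl⟩ := hs.exists_rep hc
  obtain ⟨j, hj, rfl⟩ := hd
  have hj : j < n := hj
  have hj0 : j ≠ 0 := by
    rintro rfl
    exact hcd rfl
  rw [(hf 0 j (by omega) hj).2] at hadj
  have hmem : ∀ {a b i}, a ≤ i → i < b → f i ∈ f '' Set.Ico a b :=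
    fun h1 h2 => ⟨_, ⟨h1, h2⟩, rfl⟩
  refine ⟨f '' Set.Ico 1 j, f '' Set.Ico (j + 1) n, hf.setConn_image_Ico _ hj.le,
    hf.setConn_image_Ico _ le_rfl, ?_, ?_, ?_, ?_, ?_, ?_, ?_⟩
  · ext x
    constructor
    · rintro (⟨i, hi, rfl⟩ | ⟨i, hi, rfl⟩)
      · have hi1 := hi.1
        have hi2 := hi.2
        refine ⟨⟨i, lt_trans hi.2 hj, rfl⟩, ?_⟩
        rintro (h | h)
        · have := hf.eq_of_eq (by omega) (by omega) h; omega
        · have := hf.eq_of_eq (by omega) (by omega) h; omega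
      · have hi1 := hi.1
        have hi2 := hi.2
        refine ⟨⟨i, hi.2, rfl⟩, ?_⟩
        rintro (h | h)
        · have := hf.eq_of_eq (by omega) (by omega) h; omega
        · have := hf.eq_of_eq (by omega) (by omega) h; omega
    · rintro ⟨⟨i, hi, rfl⟩, hne⟩
      have hi : i < n := hi
      have h1 : i ≠ 0 := by
        rintro rfl
        exact hne (Or.inl rfl)
      have h2 : i ≠ j := by
        rintro rfl
        exact hne (Or.inr rfl)
      rcases lt_or_gt_of_ne h2 with h3 | h3
      · exact Or.inl (hmem (by omega) h3)
      · exact Or.inr (hmem h3 hi)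
  · rw [Set.disjoint_left]
    rintro x ⟨i, ⟨hi1, hi2⟩, rfl⟩ ⟨i', ⟨hi1', hi2'⟩, h⟩
    have := hf.eq_of_eq (by omega) (by omega) h
    omega
  · rintro x ⟨i, ⟨hi1, hi2⟩, rfl⟩ y ⟨i', ⟨hi1', hi2'⟩, rfl⟩ h
    rw [hf.adj_iff (by omega) (by omega)] at h
    omega
  · exact ⟨f 1, hmem le_rfl (by omega), (hf.adj_iff (by omega) (by omega)).2 (by omega)⟩
  · exact ⟨f (j - 1), hmem (by omega) (by omega),
      (hf.adj_iff (by omega) (by omega)).2 (by omega)⟩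
  · exact ⟨f (n - 1), hmem (by omega) (by omega),
      (hf.adj_iff (by omega) (by omega)).2 (by omega)⟩
  · exact ⟨f (j + 1), hmem (by omega) (by omega),
      (hf.adj_iff (by omega) (by omega)).2 (by omega)⟩

/-- An arc of a hole between two nonadjacent vertices is minimal: no proper connected subset of it
is attached to both ends. -/
theorem IsHoleSet.subset_of_setConn {s : Set V} (hs : G.IsHoleSet s) {c d : V} (hc : c ∈ s)
    (hd : d ∈ s) (hcd : c ≠ d) (hadj : ¬ G.Adj c d) {Y Y0 : Set V} (hY : G.SetConn Y)
    (hYs : Y ⊆ s \ {c, d}) (hY0 : G.SetConn Y0) (hY0Y : Y0 ⊆ Y) (hcY : ∃ y ∈ Y0, G.Adj c y)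
    (hdY : ∃ y ∈ Y0, G.Adj d y) : Y ⊆ Y0 := by
  intro i hiY
  by_contra hiY0
  obtain ⟨I, J, hI, hJ, hIJ, hdis, hanti, hcI, -, hcJ, -⟩ := hs.exists_arcs hc hd hcd hadj
  -- It suffices to refute the case that `i` lies on the first of the two arcs.
  suffices key : ∀ I J : Set V, I ∪ J = s \ {c, d} → Disjoint I J →
      (∀ x ∈ I, ∀ y ∈ J, ¬ G.Adj x y) → (∃ x ∈ J, G.Adj c x) → i ∈ I → False by
    have hi := hYs hiY
    rw [← hIJ] at hi
    rcases hi with hi | hi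
    · exact key I J hIJ hdis hanti hcJ hi
    · exact key J I (Set.union_comm I J ▸ hIJ) hdis.symm
        (fun x hx y hy h => hanti y hy x hx h.symm) hcI hi
  clear! I J
  rintro I J hIJ hdis hanti ⟨j, hjJ, -⟩ hiI
  have hconn : ∀ W : Set V, G.SetConn W → W ⊆ s \ {c, d} → ∀ a ∈ W, a ∈ I → ∀ b ∈ W, b ∈ I := by
    intro W hW hWs a ha haI b hb
    by_contra hbI
    obtain ⟨x, -, hxI, y, hy, hyI, hxy⟩ := hW.exists_adj_boundary ha haI hb hbI
    have hy' := hWs hy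
    rw [← hIJ] at hy'
    exact hanti x hxI y (hy'.resolve_left hyI) hxy
  have hjI : j ∉ I := fun h => Set.disjoint_left.1 hdis h hjJ
  have hYI : ∀ y ∈ Y, y ∈ I := hconn Y hY hYs i hiY hiI
  have his : i ∈ s \ {c, d} := hYs hiY
  have hjs : j ∈ s \ {c, d} := hIJ ▸ Or.inr hjJ
  have hij : i ≠ j := fun h => hjI (h ▸ hiI)
  obtain ⟨I', J', hI', hJ', hIJ', hdis', hanti', ⟨a, haI', hia⟩, ⟨b, hbI', hjb⟩, ⟨a', haJ', hia'⟩,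
    ⟨b', hbJ', hjb'⟩⟩ := hs.exists_arcs his.1 hjs.1 hij (hanti i hiI j hjJ)
  -- One of the new arcs contains `c`, `Y0` and `d`; the other one joins `i` to `j` inside
  -- the union of the old arcs.
  have hbad : ∀ W : Set V, G.SetConn W → W ⊆ s \ {c, d} → ∀ a ∈ W, G.Adj i a → ∀ b ∈ W,
      G.Adj j b → False := by
    intro W hW hWs a ha hia b hb hjb
    have haI : a ∈ I := by
      by_contra haI
      have h := hWs ha
      rw [← hIJ] at h
      exact hanti i hiI a (h.resolve_left haI) hia
    have hbI := hconn W hW hWs a ha haI b hb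
    exact hanti b hbI j hjJ hjb.symm
  have hP : G.SetConn (insert c (insert d Y0)) := by
    obtain ⟨y, hy, hcy⟩ := hcY
    obtain ⟨y', hy', hdy⟩ := hdY
    exact (hY0.insert_adj hy' hdy.symm).insert_adj (Or.inr hy) hcy.symm
  have hPs : insert c (insert d Y0) ⊆ s \ {i, j} := by
    rintro x (rfl | rfl | hx)
    · refine ⟨hc, ?_⟩
      rintro (rfl | rfl)
      · exact his.2 (Or.inl rfl)
      · exact hjs.2 (Or.inl rfl)
    · refine ⟨hd, ?_⟩
      rintro (rfl | rfl)
      · exact his.2 (Or.inr rfl)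
      · exact hjs.2 (Or.inr rfl)
    · refine ⟨(hYs (hY0Y hx)).1, ?_⟩
      rintro (rfl | rfl)
      · exact hiY0 hx
      · exact hjI (hYI _ (hY0Y hx))
  have hside : ∀ I' J' : Set V, I' ∪ J' = s \ {i, j} → Disjoint I' J' →
      (∀ x ∈ I', ∀ y ∈ J', ¬ G.Adj x y) → c ∈ I' → J' ⊆ s \ {c, d} := by
    intro I' J' hIJ' hdis' hanti' hcI' x hx
    have hxI : x ∉ I' := fun h => Set.disjoint_left.1 hdis' h hx
    refine ⟨(show x ∈ s \ {i, j} from hIJ' ▸ Or.inr hx).1, ?_⟩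
    rintro (rfl | rfl)
    · exact hxI hcI'
    · obtain ⟨p, -, hpI, q, hq, hqI, hpq⟩ :=
        hP.exists_adj_boundary (Set.mem_insert c _) hcI' (Or.inr (Or.inl rfl)) hxI
      have h := hPs hq
      rw [← hIJ'] at h
      exact hanti' p hpI q (h.resolve_left hqI) hpq
  have hcm : c ∈ I' ∪ J' := hIJ' ▸ hPs (Set.mem_insert c _)
  rcases hcm with hcm | hcm
  · exact hbad J' hJ' (hside I' J' hIJ' hdis' hanti' hcm) a' haJ' hia' b' hbJ' hjb'
  · exact hbad I' hI' (hside J' I' (Set.union_comm I' J' ▸ hIJ') hdis'.symm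
      (fun x hx y hy h => hanti' y hy x hx h.symm) hcm) a haI' hia b hbI' hjb

/-- If the members of `M` in a hole do not form a clique and `h` is another vertex of the hole,
then the component of `h` outside `M` is attached to two nonadjacent members of `M`. -/
theorem IsHoleSet.exists_sector {H M : Set V} (hH : G.IsHoleSet H) (hM : M ⊆ H)
    (hMc : ¬ G.IsClique M) {h : V} (hh : h ∈ H) (hhM : h ∉ M) :
    ∃ y₁ ∈ M, ∃ y₂ ∈ M, y₁ ≠ y₂ ∧ ¬ G.Adj y₁ y₂ ∧
      (∃ y ∈ G.compIn (H \ M) h, G.Adj y₁ y) ∧ (∃ y ∈ G.compIn (H \ M) h, G.Adj y₂ y) := by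
  set Y := G.compIn (H \ M) h with hY
  have hhY : h ∈ Y := mem_compIn_self ⟨hh, hhM⟩
  set K := G.att M Y with hKdef
  have hK : ¬ G.IsClique K := by
    intro hK
    have hex : ∃ m ∈ M, m ∉ K := by
      by_contra! hcon
      exact hMc (hK.subset hcon)
    obtain ⟨m, hmM, hmK⟩ := hex
    obtain ⟨a, -, haY, b, hb, hbY, hab⟩ := (hH.setConn_diff hK).exists_adj_boundary
      (x := h) (y := m) (U := Y) ⟨hh, fun h' => hhM h'.1⟩ hhY ⟨hM hmM, hmK⟩
      (fun h' => (compIn_subset h').2 hmM)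
    by_cases hbM : b ∈ M
    · exact hb.2 ⟨hbM, a, haY, hab⟩
    · exact hbY (compIn_closed haY ⟨hb.1, hbM⟩ hab)
  obtain ⟨y₁, ⟨hy₁, z₁, hz₁, h₁⟩, y₂, ⟨hy₂, z₂, hz₂, h₂⟩, hne, hadj⟩ :=
    not_isClique_iff_exists.1 hK
  exact ⟨y₁, hy₁, y₂, hy₂, hne, hadj, ⟨z₁, hz₁, h₁.symm⟩, ⟨z₂, hz₂, h₂.symm⟩⟩

end HoleSets

section HoleLemma

variable {V : Type*} {G : SimpleGraph V}

/-! ### Building holes from connected sets -/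

/-- A walk of length `k` from `p` to `q` with vertices `f 0, …, f k`, whose interior lies in `X`. -/
def IsWalkVia (G : SimpleGraph V) (X : Set V) (p q : V) (k : ℕ) (f : ℕ → V) : Prop :=
  f 0 = p ∧ f k = q ∧ (∀ i < k, G.Adj (f i) (f (i + 1))) ∧ ∀ i, 0 < i → i < k → f i ∈ X

theorem exists_isWalkVia {X : Set V} {p q a b : V} (hX : G.SetConn X) (ha : a ∈ X) (hb : b ∈ X)
    (hpa : G.Adj p a) (hqb : G.Adj q b) : ∃ k f, G.IsWalkVia X p q k f := by
  have key : ∀ y, G.LinkedIn X a y → ∃ (k : ℕ) (f : ℕ → V), f 0 = p ∧ f (k + 1) = y ∧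
      (∀ i < k + 1, G.Adj (f i) (f (i + 1))) ∧ ∀ i, 0 < i → i ≤ k + 1 → f i ∈ X := by
    intro y hy
    induction hy with
    | refl =>
      refine ⟨0, fun i => if i = 0 then p else a, by simp, by simp, ?_, ?_⟩
      · intro i hi
        obtain rfl : i = 0 := by omega
        simpa using hpa
      · intro i hi _
        simp only [hi.ne', if_false, ha]
    | @tail c d _ hcd ih =>
      obtain ⟨k, f, h0, hk, hadj, hmem⟩ := ih
      refine ⟨k + 1, fun i => if i ≤ k + 1 then f i else d, by simp [h0], by simp, ?_, ?_⟩
      · intro i hi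
        by_cases hik : i + 1 ≤ k + 1
        · simp only [hik, show i ≤ k + 1 by omega, if_true]
          exact hadj i (by omega)
        · obtain rfl : i = k + 1 := by omega
          simp only [le_refl, if_true, hik, if_false, hk]
          exact hcd.1
      · intro i hi hi'
        dsimp only
        split_ifs with h
        · exact hmem i hi h
        · exact hcd.2.2
  obtain ⟨k, f, h0, hk, hadj, hmem⟩ := key b (hX a ha b hb)
  refine ⟨k + 2, fun i => if i ≤ k + 1 then f i else q, by simp [h0], by simp, ?_, ?_⟩
  · intro i hi
    by_cases hik : i + 1 ≤ k + 1
    · simp only [hik, show i ≤ k + 1 by omega, if_true]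
      exact hadj i (by omega)
    · obtain rfl : i = k + 1 := by omega
      simp only [le_refl, if_true, hik, if_false, hk]
      exact hqb.symm
  · intro i hi hi'
    simp only [show i ≤ k + 1 by omega, if_true]
    exact hmem i hi (by omega)

/-- A chord of a walk shortens it. -/
theorem IsWalkVia.exists_lt {X : Set V} {p q : V} {k : ℕ} {f : ℕ → V}
    (h : G.IsWalkVia X p q k f) {i j : ℕ} (hij : i + 1 < j) (hj : j ≤ k)
    (hadj : G.Adj (f i) (f j)) : ∃ k' < k, ∃ f', G.IsWalkVia X p q k' f' := by
  obtain ⟨h0, hk, hA, hm⟩ := h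
  refine ⟨k - (j - i - 1), by omega, fun m => if m ≤ i then f m else f (m + (j - i - 1)),
    by simp [h0], ?_, ?_, ?_⟩
  · dsimp only
    rw [if_neg (by omega), show k - (j - i - 1) + (j - i - 1) = k by omega, hk]
  · intro m hmk
    dsimp only
    rcases lt_trichotomy m i with h1 | rfl | h1
    · rw [if_pos (by omega), if_pos (by omega)]
      exact hA m (by omega)
    · rw [if_pos le_rfl, if_neg (by omega), show m + 1 + (j - m - 1) = j by omega]
      exact hadj
    · rw [if_neg (by omega), if_neg (by omega),
        show m + 1 + (j - i - 1) = m + (j - i - 1) + 1 by omega]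
      exact hA _ (by omega)
  · intro m h1 h2
    dsimp only
    split_ifs
    · exact hm m h1 (by omega)
    · exact hm _ (by omega) (by omega)

/-- A repeated vertex of a walk shortens it. -/
theorem IsWalkVia.exists_lt_of_eq {X : Set V} {p q : V} {k : ℕ} {f : ℕ → V}
    (h : G.IsWalkVia X p q k f) {i j : ℕ} (hij : i < j) (hj : j ≤ k) (heq : f i = f j) :
    ∃ k' < k, ∃ f', G.IsWalkVia X p q k' f' := by
  rcases hj.eq_or_lt with rfl | hj
  · exact ⟨i, hij, f, h.1, heq.trans h.2.1, fun m hm => h.2.2.1 m (by omega),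
      fun m h1 h2 => h.2.2.2 m h1 (by omega)⟩
  · exact h.exists_lt (i := i) (j := j + 1) (by omega) hj (heq ▸ h.2.2.1 j hj)

/-- Two nonadjacent vertices attached to a connected set `X` are the ends of an induced path whose
interior lies in `X`. -/
theorem exists_inducedPath {X : Set V} {p q : V} (hX : G.SetConn X) (hp : ∃ x ∈ X, G.Adj p x)
    (hq : ∃ x ∈ X, G.Adj q x) (hpq : p ≠ q) (hadj : ¬ G.Adj p q) :
    ∃ k f, 2 ≤ k ∧ G.IsWalkVia X p q k f ∧
      ∀ i j, i < j → j ≤ k → f i ≠ f j ∧ (G.Adj (f i) (f j) ↔ j = i + 1) := by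
  classical
  obtain ⟨a, ha, hpa⟩ := hp
  obtain ⟨b, hb, hqb⟩ := hq
  have hex := exists_isWalkVia hX ha hb hpa hqb
  obtain ⟨f, hf⟩ := Nat.find_spec hex
  have hmin : ¬ ∃ k' < Nat.find hex, ∃ f', G.IsWalkVia X p q k' f' := by
    rintro ⟨k', hk', hf'⟩
    exact Nat.find_min hex hk' hf'
  refine ⟨Nat.find hex, f, ?_, hf, ?_⟩
  · by_contra hlt
    have h01 : Nat.find hex = 0 ∨ Nat.find hex = 1 := by omega
    obtain ⟨h0, hk, hA, -⟩ := hf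
    rcases h01 with h | h
    · rw [h] at hk
      exact hpq (h0.symm.trans hk)
    · rw [h] at hk hA
      have := hA 0 one_pos
      rw [h0, zero_add, hk] at this
      exact hadj this
  · intro i j hij hj
    refine ⟨fun h => hmin (hf.exists_lt_of_eq hij hj h), fun h => ?_, ?_⟩
    · by_contra hne
      exact hmin (hf.exists_lt (by omega) hj h)
    · rintro rfl
      exact hf.2.2.1 i hj

theorem IsWalkVia.setConn_interior {X : Set V} {p q : V} {k : ℕ} {f : ℕ → V}
    (h : G.IsWalkVia X p q k f) : G.SetConn (f '' Set.Ioo 0 k) := by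
  have key : ∀ i, 0 < i → i < k → G.LinkedIn (f '' Set.Ioo 0 k) (f 1) (f i) := by
    intro i h0
    induction i, h0 using Nat.le_induction with
    | base => exact fun _ => .refl
    | succ i hi ih =>
      intro hik
      exact (ih (by omega)).trans
        ((h.2.2.1 i (by omega)).linkedIn ⟨i, ⟨hi, by omega⟩, rfl⟩ ⟨i + 1, ⟨by omega, hik⟩, rfl⟩)
  rintro _ ⟨i, hi, rfl⟩ _ ⟨j, hj, rfl⟩
  exact (key i hi.1 hi.2).symm.trans (key j hj.1 hj.2)

/-- Two nonadjacent vertices that are both attached to each of two connected sets without edges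
between them lie on a hole whose remaining vertices come from the two sets. -/
theorem exists_isHoleSet {X Y : Set V} {p q : V} (hX : G.SetConn X) (hY : G.SetConn Y)
    (hdis : Disjoint X Y) (hXY : ∀ x ∈ X, ∀ y ∈ Y, ¬ G.Adj x y) (hpX : p ∉ X) (hqX : q ∉ X)
    (hpY : p ∉ Y) (hqY : q ∉ Y) (hpq : p ≠ q) (hadj : ¬ G.Adj p q)
    (h₁ : ∃ x ∈ X, G.Adj p x) (h₂ : ∃ x ∈ X, G.Adj q x) (h₃ : ∃ y ∈ Y, G.Adj p y)
    (h₄ : ∃ y ∈ Y, G.Adj q y) :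
    ∃ X₀ ⊆ X, ∃ Y₀ ⊆ Y, G.SetConn X₀ ∧ G.SetConn Y₀ ∧
      (∃ x ∈ X₀, G.Adj p x) ∧ (∃ x ∈ X₀, G.Adj q x) ∧
      (∃ y ∈ Y₀, G.Adj p y) ∧ (∃ y ∈ Y₀, G.Adj q y) ∧
      G.IsHoleSet (insert p (insert q (X₀ ∪ Y₀))) := by
  obtain ⟨k, f, hk, hf, hfi⟩ := exists_inducedPath hX h₁ h₂ hpq hadj
  obtain ⟨l, g, hl, hg, hgi⟩ := exists_inducedPath hY h₄ h₃ hpq.symm (fun h => hadj h.symm)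
  have hf0 := hf.1
  have hfk := hf.2.1
  have hg0 := hg.1
  have hgl := hg.2.1
  have hfX : ∀ i, 0 < i → i < k → f i ∈ X := hf.2.2.2
  have hgY : ∀ i, 0 < i → i < l → g i ∈ Y := hg.2.2.2
  refine ⟨f '' Set.Ioo 0 k, ?_, g '' Set.Ioo 0 l, ?_, hf.setConn_interior, hg.setConn_interior,
    ⟨f 1, ⟨1, ⟨one_pos, by omega⟩, rfl⟩, ?_⟩, ⟨f (k - 1), ⟨k - 1, ⟨by omega, by omega⟩, rfl⟩, ?_⟩,
    ⟨g (l - 1), ⟨l - 1, ⟨by omega, by omega⟩, rfl⟩, ?_⟩, ⟨g 1, ⟨1, ⟨one_pos, by omega⟩, rfl⟩, ?_⟩,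
    k + l, fun i => if i ≤ k then f i else g (i - k), by omega, ?_, ?_⟩
  · rintro _ ⟨i, hi, rfl⟩
    exact hfX i hi.1 hi.2
  · rintro _ ⟨i, hi, rfl⟩
    exact hgY i hi.1 hi.2
  · rw [← hf0]
    exact (hfi 0 1 one_pos (by omega)).2.2 rfl
  · rw [← hfk]
    exact ((hfi (k - 1) k (by omega) le_rfl).2.2 (by omega)).symm
  · rw [← hgl]
    exact ((hgi (l - 1) l (by omega) le_rfl).2.2 (by omega)).symm
  · rw [← hg0]
    exact (hgi 0 1 one_pos (by omega)).2.2 rfl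
  · intro i j hij hj
    dsimp only
    by_cases hjk : j ≤ k
    · rw [if_pos hjk, if_pos (by omega)]
      have := hfi i j hij hjk
      refine ⟨this.1, this.2.trans ?_⟩
      omega
    · rw [if_neg hjk]
      by_cases hik : k ≤ i
      · -- Both terms lie on the second path; its start `q` is the end of the first one.
        have hi : (if i ≤ k then f i else g (i - k)) = g (i - k) := by
          split_ifs with h
          · obtain rfl : i = k := by omega
            rw [hfk, Nat.sub_self, hg0]
          · rfl
        rw [hi]
        have := hgi (i - k) (j - k) (by omega) (by omega)
        refine ⟨this.1, this.2.trans ?_⟩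
        omega
      · rw [if_pos (by omega)]
        have hjY : g (j - k) ∈ Y := hgY _ (by omega) (by omega)
        rcases Nat.eq_zero_or_pos i with rfl | hi0
        · rw [hf0]
          refine ⟨fun h => hpY (h ▸ hjY), ?_⟩
          have := (hgi (j - k) l (by omega) le_rfl).2
          rw [hgl] at this
          rw [G.adj_comm, this]
          omega
        · have hiX : f i ∈ X := hfX i hi0 (by omega)
          refine ⟨fun h => Set.disjoint_left.1 hdis hiX (h ▸ hjY), ?_⟩
          constructor
          · exact fun h => absurd h (hXY _ hiX _ hjY)
          · omega
  · ext x
    constructor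
    · rintro (rfl | rfl | ⟨i, hi, rfl⟩ | ⟨i, hi, rfl⟩)
      · exact ⟨0, by simp only [Set.mem_Iio]; omega, by simp [hf0]⟩
      · exact ⟨k, by simp only [Set.mem_Iio]; omega, by simp [hfk]⟩
      · have h2 := hi.2
        exact ⟨i, by simp only [Set.mem_Iio]; omega, by simp [h2.le]⟩
      · have h1 := hi.1
        have h2 := hi.2
        exact ⟨i + k, by simp only [Set.mem_Iio]; omega, by simp [h1.ne']⟩
    · rintro ⟨i, hi, rfl⟩
      have hi : i < k + l := hi
      dsimp only
      split_ifs with h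
      · rcases Nat.eq_zero_or_pos i with rfl | h0
        · exact Or.inl hf0
        · rcases h.eq_or_lt with rfl | h
          · exact Or.inr (Or.inl hfk)
          · exact Or.inr (Or.inr (Or.inl ⟨i, ⟨h0, h⟩, rfl⟩))
      · exact Or.inr (Or.inr (Or.inr ⟨i - k, ⟨by omega, by omega⟩, rfl⟩))

/-! ### Vertex sets of holes and holes as subgraphs -/

theorem IsHoleSet.isHole {s : Set V} (hs : G.IsHoleSet s) :
    G.IsHole ((⊤ : G.Subgraph).induce s) := by
  obtain ⟨n, f, hn, hf, rfl⟩ := hs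
  have hinj : Function.Injective (fun i : Fin n => (⟨f i, i, i.2, rfl⟩ : f '' Set.Iio n)) := by
    intro i j hij
    exact Fin.ext (hf.eq_of_eq i.2 j.2 (Subtype.mk.inj hij))
  have hsurj : Function.Surjective (fun i : Fin n => (⟨f i, i, i.2, rfl⟩ : f '' Set.Iio n)) := by
    rintro ⟨_, i, hi, rfl⟩
    exact ⟨⟨i, hi⟩, rfl⟩
  refine ⟨(Subgraph.isInduced_iff_exists_eq_induce_top _).2 ⟨_, rfl⟩, n, hn, ⟨RelIso.symm
    ⟨Equiv.ofBijective _ ⟨hinj, hsurj⟩, ?_⟩⟩⟩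
  intro i j
  change ((⊤ : G.Subgraph).induce (f '' Set.Iio n)).Adj (f i) (f j) ↔ _
  have hmem : ∀ i : Fin n, f i ∈ f '' Set.Iio n := fun i => ⟨i, i.2, rfl⟩
  simp only [Subgraph.induce_adj, hmem, true_and, Subgraph.top_adj]
  rw [hf.adj_iff i.2 j.2, cycleGraph_adj']
  rcases lt_trichotomy i j with hij | rfl | hij
  · rw [Fin.sub_val_of_le hij.le, Fin.coe_sub_iff_lt.2 hij]
    have : i.val < j.val := hij
    have := j.2
    omega
  · have : (i - i).val = 0 := by rw [Fin.sub_val_of_le le_rfl]; simp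
    rw [this]
    omega
  · rw [Fin.sub_val_of_le hij.le, Fin.coe_sub_iff_lt.2 hij]
    have : j.val < i.val := hij
    have := i.2
    omega

/-- Holes of an induced subgraph are holes of the whole graph. -/
theorem IsHoleSet.image_val {t : Set V} {s : Set t} (hs : (G.induce t).IsHoleSet s) :
    G.IsHoleSet (Subtype.val '' s) := by
  obtain ⟨n, f, hn, hf, rfl⟩ := hs
  refine ⟨n, fun i => (f i).1, hn, fun i j hij hj => ?_, by rw [Set.image_image]⟩
  have := hf i j hij hj
  exact ⟨fun h => this.1 (Subtype.ext h), this.2⟩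

end HoleLemma

section NonConsecutive

variable {V : Type*} {G : SimpleGraph V}

/-! ### Holes and vertices with the non-consecutive property -/

/-- The NC property of a graph with respect to the set `C`, stated for vertex sets of holes:
every hole has exactly one vertex in `C`, and a hole through `u ∈ C` and a hole that avoids `u`
have no two consecutive edges in common. Unlike a hole cover, `C` may be empty. -/
structure IsNCCover (G : SimpleGraph V) (C : Set V) : Prop where
  cover : ∀ s, G.IsHoleSet s → ∃ w ∈ C, w ∈ s
  unique : ∀ s, G.IsHoleSet s → ∀ x ∈ C, x ∈ s → ∀ y ∈ C, y ∈ s → x = y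
  nc : ∀ u ∈ C, ∀ s s', G.IsHoleSet s → G.IsHoleSet s' → u ∈ s → u ∉ s' → ∀ a b c, a ≠ c →
    a ∈ s ∩ s' → b ∈ s ∩ s' → c ∈ s ∩ s' → G.Adj a b → G.Adj b c → False

theorem SetConn.subset_of_anticomplete {W A B : Set V} (hW : G.SetConn W) (hAB : W ⊆ A ∪ B)
    (hanti : ∀ a ∈ A, ∀ b ∈ B, ¬ G.Adj a b) {x : V} (hx : x ∈ W) (hxA : x ∈ A) : W ⊆ A := by
  intro y hy
  by_contra hyA
  obtain ⟨a, -, haA, b, hb, hbA, hab⟩ := hW.exists_adj_boundary hx hxA hy hyA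
  exact hanti a haA b ((hAB hb).resolve_left hbA) hab

theorem SetConn.union_of_mem {s t : Set V} (hs : G.SetConn s) (ht : G.SetConn t) {a : V}
    (has : a ∈ s) (hat : a ∈ t) : G.SetConn (s ∪ t) := by
  have key : ∀ y ∈ s ∪ t, G.LinkedIn (s ∪ t) a y := by
    rintro y (hy | hy)
    · exact (hs a has y hy).mono Set.subset_union_left
    · exact (ht a hat y hy).mono Set.subset_union_right
  exact fun x hx y hy => (key x hx).symm.trans (key y hy)

/-- A hole through `u ∈ C` and a hole avoiding `u` cannot share a connected set that contains two
nonadjacent vertices, as such a set contains two consecutive edges. -/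
theorem IsNCCover.not_share {C : Set V} (hC : G.IsNCCover C) {u : V} (hu : u ∈ C) {s s' W : Set V}
    (hs : G.IsHoleSet s) (hs' : G.IsHoleSet s') (hus : u ∈ s) (hus' : u ∉ s') (hW : G.SetConn W)
    (hWs : W ⊆ s) (hWs' : W ⊆ s') {x y : V} (hx : x ∈ W) (hy : y ∈ W) (hxy : x ≠ y)
    (hadj : ¬ G.Adj x y) : False := by
  have hmem : ∀ a ∈ W, a ∈ s ∩ s' := fun a ha => ⟨hWs ha, hWs' ha⟩
  obtain ⟨a, -, rfl, b, hb, hbx, hab⟩ :=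
    hW.exists_adj_boundary (U := {x}) hx rfl hy (fun h => hxy h.symm)
  obtain ⟨a', -, ha', c, hc, hcU, hac⟩ :=
    hW.exists_adj_boundary (U := {a, b}) hx (Or.inl rfl) hy (by
      rintro (h | h)
      · exact hxy h.symm
      · exact hadj ((show y = b from h) ▸ hab))
  have hca : c ≠ a := fun h => hcU (Or.inl h)
  have hcb : c ≠ b := fun h => hcU (Or.inr h)
  rcases ha' with rfl | rfl
  · exact hC.nc u hu s s' hs hs' hus hus' b a' c hcb.symm (hmem _ hb) (hmem _ hx) (hmem _ hc)
      hab.symm hac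
  · exact hC.nc u hu s s' hs hs' hus hus' a a' c hca.symm (hmem _ hx) (hmem _ hb) (hmem _ hc)
      hab hac

/-- Let `H` be a hole that avoids `u ∈ C`, and let `Z` be a connected set through `u` outside `H`
whose attachments on `H` are not a clique, while connected parts of `Z` that avoid `u` attach to
`H` in cliques. Then `Z` is attached to all vertices of `H`: otherwise a hole through `u` would
use an arc of `H`. -/
theorem IsNCCover.att_eq {C : Set V} (hC : G.IsNCCover C) {u : V} (hu : u ∈ C) {H Z : Set V}
    (hH : G.IsHoleSet H) (huH : u ∉ H) (hZ : G.SetConn Z) (hZH : Disjoint Z H)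
    (hsub : ∀ Z₀ ⊆ Z, G.SetConn Z₀ → u ∉ Z₀ → G.IsClique (G.att H Z₀))
    (hnc : ¬ G.IsClique (G.att H Z)) : H ⊆ G.att H Z := by
  intro h hh
  by_contra hhM
  obtain ⟨y₁, hy₁, y₂, hy₂, hne, hadj, h₁, h₂⟩ :=
    hH.exists_sector (M := G.att H Z) (fun _ h => h.1) hnc hh hhM
  have hY : G.compIn (H \ G.att H Z) h ⊆ H \ G.att H Z := compIn_subset
  obtain ⟨X₀, hX₀, Z₀, hZ₀, hX₀c, hZ₀c, ⟨a₁, ha₁, hya₁⟩, ⟨a₂, ha₂, hya₂⟩, ⟨b₁, hb₁, hyb₁⟩,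
      ⟨b₂, hb₂, hyb₂⟩, hole⟩ :=
    exists_isHoleSet (setConn_compIn (G := G) (s := H \ G.att H Z) (x := h)) hZ
      (Set.disjoint_left.2 fun a ha haZ => Set.disjoint_left.1 hZH haZ (hY ha).1)
      (fun a ha b hb hab => (hY ha).2 ⟨(hY ha).1, b, hb, hab.symm⟩)
      (fun h => (hY h).2 hy₁) (fun h => (hY h).2 hy₂)
      (fun h => Set.disjoint_left.1 hZH h hy₁.1) (fun h => Set.disjoint_left.1 hZH h hy₂.1)
      hne hadj h₁ h₂ (by obtain ⟨z, hz, hzy⟩ := hy₁.2; exact ⟨z, hz, hzy.symm⟩)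
      (by obtain ⟨z, hz, hzy⟩ := hy₂.2; exact ⟨z, hz, hzy.symm⟩)
  have huZ₀ : u ∈ Z₀ := by
    by_contra huZ₀
    exact hadj (hsub Z₀ hZ₀ hZ₀c huZ₀ ⟨hy₁.1, b₁, hb₁, hyb₁.symm⟩ ⟨hy₂.1, b₂, hb₂, hyb₂.symm⟩ hne)
  refine hC.not_share hu hole hH (Or.inr (Or.inr (Or.inr huZ₀))) huH
    (W := insert y₁ (insert y₂ X₀))
    ((hX₀c.insert_adj ha₂ hya₂.symm).insert_adj (Or.inr ha₁) hya₁.symm) ?_ ?_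
    (x := y₁) (y := y₂) (Or.inl rfl) (Or.inr (Or.inl rfl)) hne hadj
  · exact Set.insert_subset_insert (Set.insert_subset_insert Set.subset_union_left)
  · rintro x (rfl | rfl | hx)
    · exact hy₁.1
    · exact hy₂.1
    · exact (hY (hX₀ hx)).1

/-- If the vertices of a hole are covered by two cliques, then each member of the first one has
both a neighbour and a distinct non-neighbour in the second one, and is not a member of it. -/
theorem IsHoleSet.of_subset_union {H E₁ E₂ : Set V} (hH : G.IsHoleSet H) (h₁ : G.IsClique E₁)
    (h₂ : G.IsClique E₂) (h₁H : E₁ ⊆ H) (hE : H ⊆ E₁ ∪ E₂) {w : V} (hw : w ∈ E₁) :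
    w ∉ E₂ ∧ (∃ y ∈ E₂, G.Adj w y) ∧ ∃ y ∈ E₂, w ≠ y ∧ ¬ G.Adj w y := by
  obtain ⟨y, hyH, hwy, hadj⟩ := hH.exists_not_adj (h₁H hw)
  have hy₂ : y ∈ E₂ := (hE hyH).resolve_left fun h => hadj (h₁ hw h hwy)
  have hw₂ : w ∉ E₂ := fun h => hadj (h₂ h hy₂ hwy)
  refine ⟨hw₂, ?_, y, hy₂, hwy, hadj⟩
  obtain ⟨a, -, rfl, b, hb, hbw, hab⟩ :=
    (hH.setConn_diff (K := E₁ \ {w}) (h₁.subset Set.sdiff_subset)).exists_adj_boundary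
      (x := w) (y := y) (U := {w}) ⟨h₁H hw, fun h => h.2 rfl⟩ rfl
      ⟨hyH, fun h => hadj (h₁ hw h.1 hwy)⟩ (fun h => hwy h.symm)
  exact ⟨b, (hE hb.1).resolve_left fun h => hb.2 ⟨h, hbw⟩, hab⟩

/-- In the situation of `IsNCCover.att_eq`, the vertex `u` is adjacent to all vertices of `H`.
A minimal counterexample `Z` together with `H` is a prism whose two triangles are joined by a
path through `u` and by two opposite edges of the four-cycle `H`; then the vertex of `C` on `H`
lies on a hole through `u`. -/
theorem IsNCCover.adj_of_att [Finite V] {C : Set V} (hC : G.IsNCCover C) {u : V} (hu : u ∈ C)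
    {H Z : Set V} (hH : G.IsHoleSet H) (huH : u ∉ H) (hZ : G.SetConn Z) (hZH : Disjoint Z H)
    (hsub : ∀ Z₀ ⊆ Z, G.SetConn Z₀ → u ∉ Z₀ → G.IsClique (G.att H Z₀))
    (hnc : ¬ G.IsClique (G.att H Z)) : ∀ h ∈ H, G.Adj u h := by
  obtain ⟨Z', hZ'Z, hmin⟩ := (Set.toFinite
    {W : Set V | W ⊆ Z ∧ G.SetConn W ∧ ¬ G.IsClique (G.att H W)}).exists_le_minimal
    (a := Z) ⟨le_rfl, hZ, hnc⟩
  obtain ⟨-, hZ'c, hZ'n⟩ := hmin.prop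
  have hsmall : ∀ W ⊆ Z', G.SetConn W → W ≠ Z' → G.IsClique (G.att H W) := by
    intro W hW hWc hne
    by_contra hWn
    exact hne (hW.antisymm (hmin.le_of_le ⟨hW.trans hZ'Z, hWc, hWn⟩ hW))
  have huW : ∀ W ⊆ Z, G.SetConn W → ¬ G.IsClique (G.att H W) → u ∈ W := fun W hW hWc hWn => by
    by_contra huW
    exact hWn (hsub W hW hWc huW)
  have huZ' : u ∈ Z' := huW Z' hZ'Z hZ'c hZ'n
  have hall : H ⊆ G.att H Z' :=
    hC.att_eq hu hH huH hZ'c (hZH.mono_left hZ'Z) (fun W hW => hsub W (hW.trans hZ'Z)) hZ'n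
  by_cases hsing : ∃ x ∈ Z', u ≠ x
  swap
  · push Not at hsing
    intro h hh
    obtain ⟨-, z, hz, hzh⟩ := hall hh
    rwa [hsing z hz]
  exfalso
  obtain ⟨x, hxZ, hux⟩ := hsing
  obtain ⟨z, hzZ, ⟨z', hz'⟩, hZ₁c⟩ := hZ'c.exists_diff_singleton huZ' hxZ hux
  set Z₁ := Z' \ {z} with hZ₁
  have hZ₁Z : Z₁ ⊆ Z' := Set.sdiff_subset
  have hE₁ : G.IsClique (G.att H Z₁) :=
    hsmall Z₁ hZ₁Z hZ₁c fun h => (h ▸ hzZ : z ∈ Z₁).2 rfl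
  have hE₂ : G.IsClique (G.att H {z}) :=
    hsmall {z} (by simpa using hzZ) (setConn_singleton z) fun h =>
      hz'.2 (h ▸ hZ₁Z hz' : z' ∈ ({z} : Set V))
  have hE : H ⊆ G.att H Z₁ ∪ G.att H {z} := by
    intro h hh
    obtain ⟨-, y, hy, hyh⟩ := hall hh
    by_cases hyz : y = z
    · exact Or.inr ⟨hh, y, hyz, hyh⟩
    · exact Or.inl ⟨hh, y, ⟨hy, hyz⟩, hyh⟩
  have hdis : ∀ y ∈ Z', y ∉ H := fun y hy => Set.disjoint_left.1 hZH (hZ'Z hy)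
  have hzZ₁ : ∃ y ∈ Z₁, G.Adj z y := by
    obtain ⟨a, -, rfl, b, hb, hba, hab⟩ :=
      hZ'c.exists_adj_boundary (U := {z}) hzZ rfl (hZ₁Z hz') hz'.2
    exact ⟨b, ⟨hb, hba⟩, hab⟩
  -- The four-cycle `H` has opposite edges `E₁` and `E₂`, attached to `Z₁` and to `z`. An edge
  -- `ab` of `H` with `a ∈ E₁` and `b ∈ E₂` extends to a hole through `z` and `Z₁`.
  have key : ∀ a ∈ G.att H Z₁, ∀ b ∈ G.att H {z}, G.Adj a b → a ∉ G.att H {z} →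
      b ∉ G.att H Z₁ → (∃ y ∈ G.att H {z}, a ≠ y ∧ ¬ G.Adj a y) →
      ∃ s, G.IsHoleSet s ∧ a ∈ s ∧ b ∈ s ∧ u ∈ s := by
    rintro a ha b hb hab ha2 hb1 ⟨y, hy, hay, hayn⟩
    have hza : ¬ G.Adj a z := fun h => ha2 ⟨ha.1, z, rfl, h.symm⟩
    have hzb : G.Adj z b := by
      obtain ⟨-, z₀, rfl, h⟩ := hb
      exact h
    obtain ⟨X₀, hX₀, Y₀, hY₀, -, hY₀c, ⟨x₀, hx₀, -⟩, -, ⟨y₁, hy₁, hay₁⟩, ⟨y₂, hy₂, hzy₂⟩, hole⟩ :=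
      exists_isHoleSet (p := a) (q := z) (setConn_singleton b) hZ₁c
        (Set.disjoint_left.2 fun x hx hxZ => hdis x (hZ₁Z hxZ) (by
          rw [Set.mem_singleton_iff.1 hx]; exact hb.1))
        (fun x hx y hy hxy => hb1 ⟨hb.1, y, hy, by
          rw [Set.mem_singleton_iff.1 hx] at hxy; exact hxy.symm⟩)
        (fun h => hab.ne h) (fun h => hzb.ne h) (fun h => hdis a (hZ₁Z h) ha.1)
        (fun h => h.2 rfl) (fun h => hdis z hzZ (h ▸ ha.1)) hza ⟨b, rfl, hab⟩ ⟨b, rfl, hzb⟩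
        (by obtain ⟨y, hy, hya⟩ := ha.2; exact ⟨y, hy, hya.symm⟩) hzZ₁
    have hbX : b ∈ X₀ := by
      have := hX₀ hx₀
      rw [Set.mem_singleton_iff] at this
      exact this ▸ hx₀
    have hzy : G.Adj z y := by
      obtain ⟨-, z₀, rfl, h⟩ := hy
      exact h
    have huY : u ∈ insert z Y₀ := by
      refine huW _ (Set.insert_subset (hZ'Z hzZ) (hY₀.trans (hZ₁Z.trans hZ'Z)))
        (hY₀c.insert_adj hy₂ hzy₂.symm) fun hcl => hayn (hcl ?_ ?_ hay)
      · exact ⟨ha.1, y₁, Or.inr hy₁, hay₁.symm⟩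
      · exact ⟨hy.1, z, Or.inl rfl, hzy⟩
    refine ⟨_, hole, Or.inl rfl, Or.inr (Or.inr (Or.inl hbX)), ?_⟩
    rcases huY with h | h
    · exact Or.inr (Or.inl h)
    · exact Or.inr (Or.inr (Or.inr h))
  have hE' : H ⊆ G.att H {z} ∪ G.att H Z₁ := Set.union_comm _ _ ▸ hE
  have hatt : ∀ W, G.att H W ⊆ H := fun W x hx => hx.1
  obtain ⟨w, hwC, hwH⟩ := hC.cover H hH
  have hwu : ∀ s, G.IsHoleSet s → w ∈ s → u ∈ s → False := fun s hs hws hus =>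
    huH (hC.unique s hs w hwC hws u hu hus ▸ hwH)
  rcases hE hwH with hw | hw
  · obtain ⟨hw2, ⟨b, hb, hwb⟩, hy⟩ := hH.of_subset_union hE₁ hE₂ (hatt _) hE hw
    obtain ⟨s, hs, hws, -, hus⟩ :=
      key w hw b hb hwb hw2 (hH.of_subset_union hE₂ hE₁ (hatt _) hE' hb).1 hy
    exact hwu s hs hws hus
  · obtain ⟨hw1, ⟨a, ha, hwa⟩, -⟩ := hH.of_subset_union hE₂ hE₁ (hatt _) hE' hw
    obtain ⟨ha2, -, hy⟩ := hH.of_subset_union hE₁ hE₂ (hatt _) hE ha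
    obtain ⟨s, hs, -, hws, hus⟩ := key a ha w hw hwa.symm ha2 hw1 hy
    exact hwu s hs hws hus

/-- If `u ∈ C` has two nonadjacent neighbours on a hole that avoids `u`, then `u` is adjacent to
all vertices of that hole. -/
theorem IsNCCover.adj_of_not_adj [Finite V] {C : Set V} (hC : G.IsNCCover C) {u : V} (hu : u ∈ C)
    {H : Set V} (hH : G.IsHoleSet H) (huH : u ∉ H) {x y : V} (hx : x ∈ H) (hy : y ∈ H)
    (hxy : x ≠ y) (hadj : ¬ G.Adj x y) (hux : G.Adj u x) (huy : G.Adj u y) :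
    ∀ h ∈ H, G.Adj u h := by
  refine hC.adj_of_att hu hH huH (setConn_singleton u) (by simpa using huH) ?_ ?_
  · rintro Z₀ hZ₀ - hu₀ a ⟨-, z, hz, -⟩
    have := hZ₀ hz
    rw [Set.mem_singleton_iff] at this
    exact absurd (this ▸ hz) hu₀
  · exact fun h => hadj (h ⟨hx, u, rfl, hux⟩ ⟨hy, u, rfl, huy⟩ hxy)

end NonConsecutive

section TwoSides

variable {V : Type*} {G : SimpleGraph V}

/-! ### Holes crossing between two connected sets -/

/-- The data shared by the lemmas on a hole running through two sides `A` and `B` and two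
nonadjacent vertices `p` and `q`: the sides have no edges between them, and each of `p`, `q` is
attached to both. -/
structure IsTwoSided (G : SimpleGraph V) (A B : Set V) (p q : V) : Prop where
  connA : G.SetConn A
  connB : G.SetConn B
  disj : Disjoint A B
  anti : ∀ a ∈ A, ∀ b ∈ B, ¬ G.Adj a b
  pA : p ∉ A
  pB : p ∉ B
  qA : q ∉ A
  qB : q ∉ B
  ne : p ≠ q
  not_adj : ¬ G.Adj p q
  adj_pA : ∃ a ∈ A, G.Adj p a
  adj_pB : ∃ b ∈ B, G.Adj p b
  adj_qA : ∃ a ∈ A, G.Adj q a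
  adj_qB : ∃ b ∈ B, G.Adj q b

theorem IsTwoSided.symm {A B : Set V} {p q : V} (h : G.IsTwoSided A B p q) :
    G.IsTwoSided B A p q where
  connA := h.connB
  connB := h.connA
  disj := h.disj.symm
  anti a ha b hb hab := h.anti b hb a ha hab.symm
  pA := h.pB
  pB := h.pA
  qA := h.qB
  qB := h.qA
  ne := h.ne
  not_adj := h.not_adj
  adj_pA := h.adj_pB
  adj_pB := h.adj_pA
  adj_qA := h.adj_qB
  adj_qB := h.adj_qA

/-- A hole that meets both sides passes through `p` and `q`, and its part on a side is an arc. -/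
theorem IsTwoSided.setConn_inter {A B : Set V} {p q : V} (h : G.IsTwoSided A B p q) {H : Set V}
    (hH : G.IsHoleSet H) (hHs : H ⊆ A ∪ B ∪ {p, q}) (hA : (H ∩ A).Nonempty)
    (hB : (H ∩ B).Nonempty) : p ∈ H ∧ q ∈ H ∧ G.SetConn (H ∩ B) := by
  obtain ⟨a, haH, haA⟩ := hA
  obtain ⟨b, hbH, hbB⟩ := hB
  have hbA : b ∉ A := fun h' => Set.disjoint_left.1 h.disj h' hbB
  have hmem : ∀ x y, ({x, y} : Set V) = {p, q} → x ∉ A → x ∉ B → y ∈ H := by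
    intro x y hxy hxA hxB
    by_contra hy
    obtain ⟨c, -, hcA, d, hd, hdA, hcd⟩ :=
      (hH.setConn_diff (K := {x}) (by simp)).exists_adj_boundary (U := A)
        (x := a) (y := b) ⟨haH, fun h' => hxA (Set.mem_singleton_iff.1 h' ▸ haA)⟩ haA
        ⟨hbH, fun h' => hxB (Set.mem_singleton_iff.1 h' ▸ hbB)⟩ hbA
    rcases hHs hd.1 with (hd' | hd') | hd'
    · exact hdA hd'
    · exact h.anti c hcA d hd' hcd
    · rw [← hxy] at hd'
      rcases hd' with rfl | rfl
      · exact hd.2 rfl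
      · exact hy hd.1
  have hq : q ∈ H := hmem p q rfl h.pA h.pB
  have hp : p ∈ H := hmem q p (Set.pair_comm q p) h.qA h.qB
  refine ⟨hp, hq, ?_⟩
  obtain ⟨I, J, hI, hJ, hIJ, -, -⟩ := hH.exists_arcs hp hq h.ne h.not_adj
  have hsub : ∀ W ⊆ H \ {p, q}, W ⊆ A ∪ B := fun W hW x hx =>
    (hHs (hW hx).1).resolve_right (hW hx).2
  have hI' : I ⊆ H \ {p, q} := hIJ ▸ Set.subset_union_left
  have hJ' : J ⊆ H \ {p, q} := hIJ ▸ Set.subset_union_right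
  have hpq : ∀ x, x ∈ A ∨ x ∈ B → x ∉ ({p, q} : Set V) := by
    rintro x hx (rfl | rfl)
    · exact hx.elim h.pA h.pB
    · exact hx.elim h.qA h.qB
  have haIJ : a ∈ I ∪ J := hIJ ▸ ⟨haH, hpq a (Or.inl haA)⟩
  have hbIJ : b ∈ I ∪ J := hIJ ▸ ⟨hbH, hpq b (Or.inr hbB)⟩
  have key : ∀ I J : Set V, G.SetConn I → G.SetConn J → I ∪ J = H \ {p, q} →
      a ∈ I → b ∈ I ∪ J → G.SetConn (H ∩ B) := by
    intro I J hI hJ hIJ haI hbIJ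
    have hIA : I ⊆ A := hI.subset_of_anticomplete
      (hsub I (hIJ ▸ Set.subset_union_left)) h.anti haI haA
    have hJB : J ⊆ B := hJ.subset_of_anticomplete
      (by rw [Set.union_comm]; exact hsub J (hIJ ▸ Set.subset_union_right))
      h.symm.anti (hbIJ.resolve_left fun h' => hbA (hIA h')) hbB
    have : H ∩ B = J := by
      ext x
      constructor
      · rintro ⟨hxH, hxB⟩
        have hx : x ∈ I ∪ J := hIJ ▸ ⟨hxH, hpq x (Or.inr hxB)⟩
        exact hx.resolve_left fun h' => Set.disjoint_left.1 h.disj (hIA h') hxB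
      · exact fun hx => ⟨(show x ∈ H \ {p, q} from hIJ ▸ Or.inr hx).1, hJB hx⟩
    rw [this]
    exact hJ
  rcases haIJ with haI | haJ
  · exact key I J hI hJ hIJ haI hbIJ
  · exact key J I hJ hI (Set.union_comm I J ▸ hIJ) haJ (Set.union_comm I J ▸ hbIJ)

/-- If a connected set `Z₀` on the side `A` attaches to the hole in a non-clique, then the hole can
be rerouted through `Z₀`, without changes on the side `B`. -/
theorem IsTwoSided.exists_reroute {A B : Set V} {p q : V} (h : G.IsTwoSided A B p q) {H Z₀ : Set V}
    (hH : G.IsHoleSet H) (hHs : H ⊆ A ∪ B ∪ {p, q}) (hA : (H ∩ A).Nonempty)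
    (hB : (H ∩ B).Nonempty) (hZ : G.SetConn Z₀) (hZA : Z₀ ⊆ A) (hZH : Disjoint Z₀ H)
    (hnc : ¬ G.IsClique (G.att H Z₀)) :
    ∃ H₁, G.IsHoleSet H₁ ∧ H₁ ⊆ H ∪ Z₀ ∧ (H₁ ∩ Z₀).Nonempty ∧ H ∩ B ⊆ H₁ := by
  obtain ⟨hp, hq, hconn⟩ := h.setConn_inter hH hHs hA hB
  obtain ⟨b, hbH, hbB⟩ := hB
  have hBM : ∀ x ∈ H ∩ B, x ∉ G.att H Z₀ := fun x hx ⟨_, z, hz, hzx⟩ =>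
    h.anti z (hZA hz) x hx.2 hzx
  obtain ⟨y₁, hy₁, y₂, hy₂, hne, hadj, h₁, h₂⟩ :=
    hH.exists_sector (M := G.att H Z₀) (fun _ h => h.1) hnc hbH (hBM b ⟨hbH, hbB⟩)
  set Y := G.compIn (H \ G.att H Z₀) b with hYdef
  have hY : Y ⊆ H \ G.att H Z₀ := compIn_subset
  have hYc : G.SetConn Y := setConn_compIn
  have hBY : H ∩ B ⊆ Y := SetConn.subset_compIn (s := H \ G.att H Z₀) (y := b) hconn
    (fun x hx => ⟨hx.1, hBM x hx⟩) ⟨hbH, hbB⟩ (mem_compIn_self ⟨hbH, hBM b ⟨hbH, hbB⟩⟩)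
  obtain ⟨X₀, hX₀, Z₁, hZ₁, hX₀c, -, hyX₁, hyX₂, ⟨z, hz, -⟩, -, hole⟩ :=
    exists_isHoleSet hYc hZ
      (Set.disjoint_left.2 fun a ha haZ => Set.disjoint_left.1 hZH haZ (hY ha).1)
      (fun a ha b hb hab => (hY ha).2 ⟨(hY ha).1, b, hb, hab.symm⟩)
      (fun h => (hY h).2 hy₁) (fun h => (hY h).2 hy₂)
      (fun h => Set.disjoint_left.1 hZH h hy₁.1) (fun h => Set.disjoint_left.1 hZH h hy₂.1)
      hne hadj h₁ h₂ (by obtain ⟨z, hz, hzy⟩ := hy₁.2; exact ⟨z, hz, hzy.symm⟩)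
      (by obtain ⟨z, hz, hzy⟩ := hy₂.2; exact ⟨z, hz, hzy.symm⟩)
  have hYX : Y ⊆ X₀ := by
    refine hH.subset_of_setConn hy₁.1 hy₂.1 hne hadj hYc (fun x hx => ⟨(hY hx).1, ?_⟩) hX₀c hX₀
      hyX₁ hyX₂
    rintro (rfl | rfl)
    · exact (hY hx).2 hy₁
    · exact (hY hx).2 hy₂
  refine ⟨_, hole, ?_, ⟨z, Or.inr (Or.inr (Or.inr hz)), hZ₁ hz⟩,
    fun x hx => Or.inr (Or.inr (Or.inl (hYX (hBY hx))))⟩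
  rintro x (rfl | rfl | hx | hx)
  · exact Or.inl hy₁.1
  · exact Or.inl hy₂.1
  · exact Or.inl (hY (hX₀ hx)).1
  · exact Or.inr (hZ₁ hx)

/-- A connected set through `u` that meets `H` contains a connection from `u` to `H` whose other
vertices avoid `H`. -/
theorem SetConn.exists_link {S H : Set V} {u : V} (hS : G.SetConn S) (hu : u ∈ S) (huH : u ∉ H)
    (hSH : (S ∩ H).Nonempty) :
    ∃ Z : Set V, u ∉ Z ∧ Z ⊆ S \ H ∧ G.SetConn (insert u Z) ∧
      ∃ z ∈ insert u Z, ∃ h ∈ S ∩ H, G.Adj z h := by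
  have huW : u ∈ G.compIn (S \ H) u := mem_compIn_self ⟨hu, huH⟩
  have hins : insert u (G.compIn (S \ H) u \ {u}) = G.compIn (S \ H) u := by
    rw [Set.insert_sdiff_singleton, Set.insert_eq_of_mem huW]
  refine ⟨G.compIn (S \ H) u \ {u}, fun h => h.2 rfl, fun x hx => compIn_subset hx.1, ?_, ?_⟩
  · rw [hins]
    exact setConn_compIn
  · rw [hins]
    obtain ⟨h, hhS, hhH⟩ := hSH
    obtain ⟨z, -, hz, b, hbS, hb, hzb⟩ := hS.exists_adj_boundary hu huW hhS
      (fun h' => (compIn_subset h').2 hhH)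
    refine ⟨z, hz, b, ⟨hbS, ?_⟩, hzb⟩
    by_contra hbH
    exact hb (compIn_closed hz ⟨hbS, hbH⟩ hzb)

/-- A hole `H` through the two sides, together with disjoint connections `Za` and `Zb`, inside the
respective side, from `u` to the part of `H` on that side. -/
structure IsLinkedHole (G : SimpleGraph V) (A B : Set V) (p q u : V) (H Za Zb : Set V) : Prop where
  hole : G.IsHoleSet H
  subset : H ⊆ A ∪ B ∪ {p, q}
  notMem : u ∉ H
  meetA : (H ∩ A).Nonempty
  meetB : (H ∩ B).Nonempty
  subA : Za ⊆ A \ H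
  subB : Zb ⊆ B \ H
  connA : G.SetConn (insert u Za)
  connB : G.SetConn (insert u Zb)
  linkA : ∃ z ∈ insert u Za, ∃ h ∈ H ∩ A, G.Adj z h
  linkB : ∃ z ∈ insert u Zb, ∃ h ∈ H ∩ B, G.Adj z h

theorem IsLinkedHole.symm {A B : Set V} {p q u : V} {H Za Zb : Set V}
    (h : G.IsLinkedHole A B p q u H Za Zb) : G.IsLinkedHole B A p q u H Zb Za where
  hole := h.hole
  subset := by rw [Set.union_comm B A]; exact h.subset
  notMem := h.notMem
  meetA := h.meetB
  meetB := h.meetA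
  subA := h.subB
  subB := h.subA
  connA := h.connB
  connB := h.connA
  linkA := h.linkB
  linkB := h.linkA

/-- Rerouting the hole through a part of the connection shortens the connection. -/
theorem IsLinkedHole.exists_lt [Finite V] {A B : Set V} {p q u : V}
    (hAB : G.IsTwoSided A B p q) (huA : u ∉ A) {H Za Zb : Set V}
    (h : G.IsLinkedHole A B p q u H Za Zb) {Z₀ : Set V} (hZ₀ : Z₀ ⊆ Za) (hZ₀c : G.SetConn Z₀)
    (hnc : ¬ G.IsClique (G.att H Z₀)) :
    ∃ H₁ Za₁, G.IsLinkedHole A B p q u H₁ Za₁ Zb ∧ Za₁.ncard < Za.ncard := by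
  have hZaA : Za ⊆ A := fun x hx => (h.subA hx).1
  have hZ₀A : Z₀ ⊆ A := hZ₀.trans hZaA
  obtain ⟨H₁, hole₁, hsub₁, ⟨z, hzH₁, hzZ₀⟩, hB₁⟩ := hAB.exists_reroute h.hole h.subset h.meetA
    h.meetB hZ₀c hZ₀A (Set.disjoint_left.2 fun x hx => (h.subA (hZ₀ hx)).2) hnc
  have huH₁ : u ∉ H₁ := fun h' => (hsub₁ h').elim h.notMem fun h' => huA (hZ₀A h')
  obtain ⟨Za₁, huZa₁, hZa₁, hconn₁, y, hy, b, ⟨hbS, hbH⟩, hyb⟩ :=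
    h.connA.exists_link (Set.mem_insert u _) huH₁ ⟨z, Or.inr (hZ₀ hzZ₀), hzH₁⟩
  have hsubZ : Za₁ ⊆ Za := fun x hx =>
    (hZa₁ hx).1.resolve_left fun h' => huZa₁ (h' ▸ hx)
  have hbA : b ∈ A := hbS.elim (fun h' => absurd (h' ▸ hbH) huH₁) fun h' => hZaA h'
  refine ⟨H₁, Za₁, ⟨hole₁, ?_, huH₁, ⟨z, hzH₁, hZ₀A hzZ₀⟩, ?_, ?_, ?_, hconn₁, h.connB,
    ⟨y, hy, b, ⟨hbH, hbA⟩, hyb⟩, ?_⟩, Set.ncard_lt_ncard (hsubZ.ssubset_of_ne fun h' => ?_)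
      (Set.toFinite _)⟩
  · intro x hx
    rcases hsub₁ hx with hx | hx
    · exact h.subset hx
    · exact Or.inl (Or.inl (hZ₀A hx))
  · obtain ⟨x, hx⟩ := h.meetB
    exact ⟨x, hB₁ hx, hx.2⟩
  · exact fun x hx => ⟨hZaA (hsubZ hx), (hZa₁ hx).2⟩
  · refine fun x hx => ⟨(h.subB hx).1, fun hxH => ?_⟩
    rcases hsub₁ hxH with h' | h'
    · exact (h.subB hx).2 h'
    · exact Set.disjoint_left.1 hAB.disj (hZ₀A h') (h.subB hx).1
  · obtain ⟨z', hz', x, hx, hzx⟩ := h.linkB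
    exact ⟨z', hz', x, ⟨hB₁ hx, hx.2⟩, hzx⟩
  · have : z ∈ Za₁ := h' ▸ hZ₀ hzZ₀
    exact (hZa₁ this).2 hzH₁

/-- A hole through the two sides with shortest possible connections to `u ∈ C` is complete
to `u`. -/
theorem IsNCCover.exists_complete_of_linked [Finite V] {C : Set V} (hC : G.IsNCCover C) {u : V}
    (hu : u ∈ C) {A B : Set V} {p q : V} (hAB : G.IsTwoSided A B p q) (huA : u ∉ A) (huB : u ∉ B)
    {H Za Zb : Set V} (h : G.IsLinkedHole A B p q u H Za Zb) :
    ∃ H, G.IsHoleSet H ∧ u ∉ H ∧ p ∈ H ∧ q ∈ H ∧ H ⊆ A ∪ B ∪ {p, q} ∧ ∀ x ∈ H, G.Adj u x := by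
  induction hn : Za.ncard + Zb.ncard using Nat.strong_induction_on generalizing H Za Zb with
  | _ n ih =>
    subst hn
    by_cases hbad : ∃ Z₀, (Z₀ ⊆ Za ∨ Z₀ ⊆ Zb) ∧ G.SetConn Z₀ ∧ ¬ G.IsClique (G.att H Z₀)
    · obtain ⟨Z₀, hZ₀ | hZ₀, hc, hnc⟩ := hbad
      · obtain ⟨H₁, Za₁, h₁, hlt⟩ := h.exists_lt hAB huA hZ₀ hc hnc
        exact ih _ (Nat.add_lt_add_right hlt _) h₁ rfl
      · obtain ⟨H₁, Zb₁, h₁, hlt⟩ := h.symm.exists_lt hAB.symm huB hZ₀ hc hnc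
        exact ih _ (Nat.add_lt_add_left hlt _) h₁.symm rfl
    · obtain ⟨hp, hq, -⟩ := hAB.setConn_inter h.hole h.subset h.meetA h.meetB
      refine ⟨H, h.hole, h.notMem, hp, hq, h.subset, ?_⟩
      have hanti : ∀ a ∈ Za, ∀ b ∈ Zb, ¬ G.Adj a b := fun a ha b hb =>
        hAB.anti a (h.subA ha).1 b (h.subB hb).1
      refine hC.adj_of_att hu h.hole h.notMem
        (h.connA.union_of_mem h.connB (Set.mem_insert u Za) (Set.mem_insert u Zb)) ?_ ?_ ?_
      · rw [Set.disjoint_left]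
        rintro x ((rfl | hx) | (rfl | hx))
        · exact h.notMem
        · exact (h.subA hx).2
        · exact h.notMem
        · exact (h.subB hx).2
      · intro Z₀ hZ₀ hZ₀c huZ₀
        have hsub : Z₀ ⊆ Za ∪ Zb := by
          intro x hx
          rcases hZ₀ hx with (rfl | hx') | (rfl | hx')
          · exact absurd hx huZ₀
          · exact Or.inl hx'
          · exact absurd hx huZ₀
          · exact Or.inr hx'
        by_contra hnc
        obtain ⟨-, ⟨-, z, hz, -⟩, -⟩ := not_isClique_iff_exists.1 hnc
        refine hbad ⟨Z₀, ?_, hZ₀c, hnc⟩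
        rcases hsub hz with hza | hzb
        · exact Or.inl (hZ₀c.subset_of_anticomplete hsub hanti hz hza)
        · exact Or.inr (hZ₀c.subset_of_anticomplete (Set.union_comm Za Zb ▸ hsub)
            (fun a ha b hb hab => hanti b hb a ha hab.symm) hz hzb)
      · intro hcl
        obtain ⟨z, hz, a, ha, hza⟩ := h.linkA
        obtain ⟨z', hz', b, hb, hzb⟩ := h.linkB
        exact hAB.anti a ha.2 b hb.2 (hcl ⟨ha.1, z, Or.inl hz, hza⟩ ⟨hb.1, z', Or.inr hz', hzb⟩
          fun hab => Set.disjoint_left.1 hAB.disj ha.2 (hab ▸ hb.2))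

/-- Let `u ∈ C` have neighbours on both sides. Then some hole through the two sides is complete
to `u`; in particular `u` is adjacent to `p` and `q`. -/
theorem IsNCCover.exists_complete [Finite V] {C : Set V} (hC : G.IsNCCover C) {u : V}
    (hu : u ∈ C) {A B : Set V} {p q : V} (hAB : G.IsTwoSided A B p q) (huA : u ∉ A) (huB : u ∉ B)
    (hup : u ≠ p) (huq : u ≠ q) (hadjA : ∃ a ∈ A, G.Adj u a) (hadjB : ∃ b ∈ B, G.Adj u b) :
    ∃ H, G.IsHoleSet H ∧ u ∉ H ∧ p ∈ H ∧ q ∈ H ∧ H ⊆ A ∪ B ∪ {p, q} ∧ ∀ x ∈ H, G.Adj u x := by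
  obtain ⟨X₀, hX₀, Y₀, hY₀, -, -, ⟨x, hx, -⟩, -, ⟨y, hy, -⟩, -, hole⟩ :=
    exists_isHoleSet hAB.connA hAB.connB hAB.disj hAB.anti hAB.pA hAB.qA hAB.pB hAB.qB hAB.ne
      hAB.not_adj hAB.adj_pA hAB.adj_qA hAB.adj_pB hAB.adj_qB
  set H := insert p (insert q (X₀ ∪ Y₀)) with hH
  have huH : u ∉ H := by
    rintro (h | h | h | h)
    · exact hup h
    · exact huq h
    · exact huA (hX₀ h)
    · exact huB (hY₀ h)
  have hlink : ∀ S : Set V, G.SetConn S → u ∉ S → (∃ a ∈ S, G.Adj u a) → (H ∩ S).Nonempty →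
      ∃ Z, Z ⊆ S \ H ∧ G.SetConn (insert u Z) ∧ ∃ z ∈ insert u Z, ∃ h ∈ H ∩ S, G.Adj z h := by
    rintro S hS huS ⟨a, ha, hua⟩ ⟨b, hbH, hbS⟩
    obtain ⟨Z, huZ, hZ, hZc, z, hz, h, ⟨hhS, hhH⟩, hzh⟩ := (hS.insert_adj ha hua.symm).exists_link
      (Set.mem_insert u S) huH ⟨b, Or.inr hbS, hbH⟩
    refine ⟨Z, fun c hc => ⟨(hZ hc).1.resolve_left fun h' => huZ (h' ▸ hc), (hZ hc).2⟩, hZc, z, hz,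
      h, ⟨hhH, hhS.resolve_left fun h' => huH (h' ▸ hhH)⟩, hzh⟩
  have hmA : (H ∩ A).Nonempty := ⟨x, Or.inr (Or.inr (Or.inl hx)), hX₀ hx⟩
  have hmB : (H ∩ B).Nonempty := ⟨y, Or.inr (Or.inr (Or.inr hy)), hY₀ hy⟩
  obtain ⟨Za, hZa, hZac, hla⟩ := hlink A hAB.connA huA hadjA hmA
  obtain ⟨Zb, hZb, hZbc, hlb⟩ := hlink B hAB.connB huB hadjB hmB
  refine hC.exists_complete_of_linked hu hAB huA huB (H := H) (Za := Za) (Zb := Zb)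
    ⟨hole, ?_, huH, hmA, hmB, hZa, hZb, hZac, hZbc, hla, hlb⟩
  rintro c (rfl | rfl | h | h)
  · exact Or.inr (Or.inl rfl)
  · exact Or.inr (Or.inr rfl)
  · exact Or.inl (Or.inl (hX₀ h))
  · exact Or.inl (Or.inr (hY₀ h))

/-- In the same situation, `u` is adjacent to every vertex `t` outside the two sides that is
attached to both of them. If it were not, then `t` would be complete to a hole that is complete
to `u`, and `u` and the vertex of `C` on that hole would lie on a common four-cycle. -/
theorem IsNCCover.adj_of_twoSided [Finite V] {C : Set V} (hC : G.IsNCCover C) {u : V}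
    (hu : u ∈ C) {A B : Set V} {p q : V} (hAB : G.IsTwoSided A B p q) (huA : u ∉ A) (huB : u ∉ B)
    (hup : u ≠ p) (huq : u ≠ q) (hadjA : ∃ a ∈ A, G.Adj u a) (hadjB : ∃ b ∈ B, G.Adj u b) {t : V}
    (htu : u ≠ t) (htA : t ∉ A) (htB : t ∉ B) (hta : ∃ a ∈ A, G.Adj t a)
    (htb : ∃ b ∈ B, G.Adj t b) : G.Adj u t := by
  by_contra hut
  obtain ⟨H, hH, huH, hp, hq, hHs, hcomp⟩ :=
    hC.exists_complete hu hAB huA huB hup huq hadjA hadjB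
  have htH : t ∉ H := fun h => hut (hcomp t h)
  -- A non-neighbour of `t` among `p` and `q` could take the place of the other one.
  have ht : ∀ x ∈ H, x ∉ A → x ∉ B → (∃ a ∈ A, G.Adj x a) → (∃ b ∈ B, G.Adj x b) → u ≠ x →
      G.Adj t x := by
    intro x hxH hxA hxB hxa hxb hux
    by_contra htx
    have hAB' : G.IsTwoSided A B t x := ⟨hAB.connA, hAB.connB, hAB.disj, hAB.anti, htA, htB, hxA,
      hxB, fun h => htH (h ▸ hxH), htx, hta, htb, hxa, hxb⟩
    obtain ⟨H', -, -, ht', -, -, hcomp'⟩ :=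
      hC.exists_complete hu hAB' huA huB htu hux hadjA hadjB
    exact hut (hcomp' t ht')
  have htp : G.Adj t p := ht p hp hAB.pA hAB.pB hAB.adj_pA hAB.adj_pB hup
  have htq : G.Adj t q := ht q hq hAB.qA hAB.qB hAB.adj_qA hAB.adj_qB huq
  have htcomp : ∀ x ∈ H, G.Adj t x := by
    by_contra! hcon
    obtain ⟨x, hx, htx⟩ := hcon
    obtain ⟨y₁, hy₁, y₂, hy₂, hne, hadj, h₁, h₂⟩ :=
      hH.exists_sector (M := {y ∈ H | G.Adj t y}) (fun _ h => h.1)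
        (fun hcl => hAB.not_adj (hcl ⟨hp, htp⟩ ⟨hq, htq⟩ hAB.ne)) hx (fun h => htx h.2)
    have hY : G.compIn (H \ {y ∈ H | G.Adj t y}) x ⊆ H \ {y ∈ H | G.Adj t y} := compIn_subset
    obtain ⟨X₀, hX₀, T, hT, -, -, -, -, ⟨t', ht', -⟩, -, hole⟩ :=
      exists_isHoleSet (setConn_compIn (G := G) (s := H \ {y ∈ H | G.Adj t y}) (x := x))
        (setConn_singleton t)
        (Set.disjoint_left.2 fun a ha hat => htH (by
          rw [← Set.mem_singleton_iff.1 hat]; exact (hY ha).1))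
        (fun a ha b hb hab => (hY ha).2 ⟨(hY ha).1, by
          rw [Set.mem_singleton_iff.1 hb] at hab; exact hab.symm⟩)
        (fun h => (hY h).2 hy₁) (fun h => (hY h).2 hy₂) (fun h => hy₁.2.ne h.symm)
        (fun h => hy₂.2.ne h.symm) hne hadj h₁ h₂ ⟨t, rfl, hy₁.2.symm⟩ ⟨t, rfl, hy₂.2.symm⟩
    have htT : t ∈ T := by
      have := hT ht'
      rw [Set.mem_singleton_iff] at this
      exact this ▸ ht'
    refine hut (hC.adj_of_not_adj hu hole ?_ (Or.inl rfl) (Or.inr (Or.inl rfl)) hne hadj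
      (hcomp _ hy₁.1) (hcomp _ hy₂.1) t (Or.inr (Or.inr (Or.inr htT))))
    rintro (h | h | h | h)
    · exact huH (h ▸ hy₁.1)
    · exact huH (h ▸ hy₂.1)
    · exact huH (hY (hX₀ h)).1
    · exact htu (hT h)
  obtain ⟨w, hwC, hwH⟩ := hC.cover H hH
  obtain ⟨y, hyH, hwy, hadj⟩ := hH.exists_not_adj hwH
  obtain ⟨X₀, hX₀, T, hT, -, -, ⟨u', hu', -⟩, -, -, -, hole⟩ :=
    exists_isHoleSet (p := w) (q := y) (setConn_singleton u) (setConn_singleton t)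
      (by simpa using htu)
      (fun a ha b hb hab => hut (by
        rwa [Set.mem_singleton_iff.1 ha, Set.mem_singleton_iff.1 hb] at hab))
      (fun h => huH (h ▸ hwH)) (fun h => huH (h ▸ hyH)) (fun h => htH (h ▸ hwH))
      (fun h => htH (h ▸ hyH)) hwy hadj ⟨u, rfl, (hcomp w hwH).symm⟩ ⟨u, rfl, (hcomp y hyH).symm⟩
      ⟨t, rfl, (htcomp w hwH).symm⟩ ⟨t, rfl, (htcomp y hyH).symm⟩
  have huX : u ∈ X₀ := by
    have := hX₀ hu'
    rw [Set.mem_singleton_iff] at this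
    exact this ▸ hu'
  exact huH (hC.unique _ hole w hwC (Or.inl rfl) u hu (Or.inr (Or.inr (Or.inl huX))) ▸ hwH)

end TwoSides

section CliqueCutsets

variable {V : Type*} {G : SimpleGraph V}

/-! ### Graphs without clique cutsets -/

/-- The vertices other than `u` that no clique of `G - u` separates from `H` in `G - u`. -/
def core (G : SimpleGraph V) (H : Set V) (u : V) : Set V :=
  {x | x ≠ u ∧ ∀ K, G.IsClique K → u ∉ K → x ∉ K → ∃ h ∈ H \ K, G.LinkedIn (insert u K)ᶜ x h}

theorem subset_core {H : Set V} {u : V} (huH : u ∉ H) : H ⊆ G.core H u :=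
  fun h hh => ⟨fun h' => huH (h' ▸ hh), fun _ _ _ hK => ⟨h, ⟨hh, hK⟩, .refl⟩⟩

theorem IsHoleSet.linkedIn_of_mem_core {H : Set V} {u : V} (hH : G.IsHoleSet H) (huH : u ∉ H)
    {x y : V} (hx : x ∈ G.core H u) (hy : y ∈ G.core H u) {K : Set V} (hK : G.IsClique K)
    (huK : u ∉ K) (hxK : x ∉ K) (hyK : y ∉ K) : G.LinkedIn (insert u K)ᶜ x y := by
  obtain ⟨h, hh, hxh⟩ := hx.2 K hK huK hxK
  obtain ⟨h', hh', hyh⟩ := hy.2 K hK huK hyK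
  refine hxh.trans (((hH.setConn_diff hK h hh h' hh').mono ?_).trans hyh.symm)
  rintro c hc (rfl | hcK)
  · exact huH hc.1
  · exact hc.2 hcK

/-- The set `T` separates `Da` from `Db` in `G - u`, lies in the core, is not a clique, and all its
vertices are attached to both `Da` and `Db`. -/
structure IsCoreSeparation (G : SimpleGraph V) (H : Set V) (u : V) (Da Db T : Set V) : Prop where
  connA : G.SetConn Da
  connB : G.SetConn Db
  disj : Disjoint Da Db
  anti : ∀ a ∈ Da, ∀ b ∈ Db, ¬ G.Adj a b
  notMemA : u ∉ Da
  notMemB : u ∉ Db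
  not_clique : ¬ G.IsClique T
  subset : T ⊆ G.core H u
  disjA : ∀ t ∈ T, t ∉ Da
  disjB : ∀ t ∈ T, t ∉ Db
  adjA : ∀ t ∈ T, ∃ a ∈ Da, G.Adj t a
  adjB : ∀ t ∈ T, ∃ b ∈ Db, G.Adj t b
  closedA : ∀ x ∈ Da, ∀ y, y ≠ u → y ∉ T → G.Adj x y → y ∈ Da
  closedB : ∀ x ∈ Db, ∀ y, y ≠ u → y ∉ T → G.Adj x y → y ∈ Db

/-- Nonadjacent vertices of the core are separated in `G - u` by a non-clique inside the core. -/
theorem IsHoleSet.exists_isCoreSeparation {H : Set V} {u : V} (hH : G.IsHoleSet H) (huH : u ∉ H)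
    {a b : V} (ha : a ∈ G.core H u) (hb : b ∈ G.core H u) (hab : a ≠ b) (hadj : ¬ G.Adj a b) :
    ∃ Da Db T, G.IsCoreSeparation H u Da Db T ∧ a ∈ Da ∧ b ∈ Db := by
  set S : Set V := {x | x ≠ u ∧ x ≠ a ∧ ¬ G.Adj a x} with hS
  have hbS : b ∈ S := ⟨hb.1, hab.symm, hadj⟩
  set Db := G.compIn S b with hDb
  have hDbS : Db ⊆ S := compIn_subset
  have hDbc : G.SetConn Db := setConn_compIn
  have hbDb : b ∈ Db := mem_compIn_self hbS
  set T : Set V := {t | t ≠ u ∧ t ∉ Db ∧ ∃ d ∈ Db, G.Adj t d} with hT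
  -- As `Db` is a component of the non-neighbours of `a`, its neighbours are neighbours of `a`.
  have hTa : ∀ t ∈ T, G.Adj a t := by
    rintro t ⟨htu, htD, d, hd, htd⟩
    by_contra hat
    refine htD (compIn_closed hd ⟨htu, ?_, hat⟩ htd.symm)
    rintro rfl
    exact (hDbS hd).2.2 htd
  have haT : a ∉ T := fun h => (hTa a h).ne rfl
  have huT : u ∉ T := fun h => h.1 rfl
  have haDb : a ∉ Db := fun h => (hDbS h).2.1 rfl
  have haU : a ∈ (insert u T)ᶜ := by
    rintro (h | h)
    · exact ha.1 h
    · exact haT h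
  set Da := G.compIn (insert u T)ᶜ a with hDa
  have hDaS : Da ⊆ (insert u T)ᶜ := compIn_subset
  have hDac : G.SetConn Da := setConn_compIn
  have haDa : a ∈ Da := mem_compIn_self haU
  have hclB : ∀ x ∈ Db, ∀ y, y ≠ u → y ∉ T → G.Adj x y → y ∈ Db := by
    intro x hx y hyu hyT hxy
    by_contra hy
    exact hyT ⟨hyu, hy, x, hx, hxy.symm⟩
  have hdisj : ∀ x ∈ Da, x ∉ Db := by
    intro x hx hxD
    obtain ⟨c, -, hc, d, hd, hdD, hcd⟩ := hDac.exists_adj_boundary hx hxD haDa haDb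
    exact hdD (hclB c hc d (fun h => hDaS hd (Or.inl h)) (fun h => hDaS hd (Or.inr h)) hcd)
  have hanti : ∀ x ∈ Da, ∀ y ∈ Db, ¬ G.Adj x y := by
    intro x hx y hy hxy
    exact hdisj x hx (hclB y hy x (fun h => hDaS hx (Or.inl h)) (fun h => hDaS hx (Or.inr h))
      hxy.symm)
  refine ⟨Da, Db, T, ⟨hDac, hDbc, Set.disjoint_left.2 hdisj, hanti, fun h => hDaS h (Or.inl rfl),
    fun h => (hDbS h).1 rfl, fun hcl => ?_, fun t ht => ⟨ht.1, fun K hK huK htK => ?_⟩,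
    fun t ht h => hDaS h (Or.inr ht), fun t ht => ht.2.1, fun t ht => ⟨a, haDa, (hTa t ht).symm⟩,
    fun t ht => ht.2.2, fun x hx y hyu hyT hxy => compIn_closed hx ?_ hxy, hclB⟩, haDa, hbDb⟩
  · exact hdisj b ⟨fun h => h.elim (fun h' => hb.1 h') fun h' => h'.2.1 hbDb,
      hH.linkedIn_of_mem_core huH ha hb hcl huT haT fun h => h.2.1 hbDb⟩ hbDb
  · have htU : t ∈ (insert u K)ᶜ := fun h => h.elim ht.1 htK
    -- A clique cannot meet both of `Da` and `Db`, so `t` reaches `a` or `b` outside `K`.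
    by_cases haK : a ∈ K
    · have hDbK : Db ⊆ (insert u K)ᶜ := by
        rintro x hx (rfl | hxK)
        · exact (hDbS hx).1 rfl
        · exact (hDbS hx).2.2 (hK haK hxK (hDbS hx).2.1.symm)
      obtain ⟨d, hd, htd⟩ := ht.2.2
      obtain ⟨h, hh, hbh⟩ := hb.2 K hK huK fun h => hDbK hbDb (Or.inr h)
      exact ⟨h, hh, (htd.linkedIn htU (hDbK hd)).trans (((hDbc d hd b hbDb).mono hDbK).trans hbh)⟩
    · obtain ⟨h, hh, hah⟩ := ha.2 K hK huK haK
      exact ⟨h, hh, ((hTa t ht).symm.linkedIn htU fun h => h.elim ha.1 haK).trans hah⟩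
  · exact fun h => h.elim hyu hyT

/-- The neighbours in the core of a connected set outside the core form a clique. -/
theorem IsHoleSet.adj_of_core {H : Set V} {u : V} (hH : G.IsHoleSet H) (huH : u ∉ H) {L : Set V}
    (hL : G.SetConn L) (huL : u ∉ L) (hLc : ∀ x ∈ L, x ∉ G.core H u) {a b : V}
    (ha : a ∈ G.core H u) (hb : b ∈ G.core H u) (hab : a ≠ b) (haL : ∃ x ∈ L, G.Adj a x)
    (hbL : ∃ x ∈ L, G.Adj b x) : G.Adj a b := by
  by_contra hadj
  obtain ⟨Da, Db, T, h, haD, hbD⟩ := hH.exists_isCoreSeparation huH ha hb hab hadj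
  obtain ⟨x, hx, hax⟩ := haL
  obtain ⟨y, hy, hby⟩ := hbL
  have hout : ∀ z ∈ L, z ≠ u ∧ z ∉ T := fun z hz =>
    ⟨fun h' => huL (h' ▸ hz), fun h' => hLc z hz (h.subset h')⟩
  have hxD : x ∈ Da := h.closedA a haD x (hout x hx).1 (hout x hx).2 hax
  have hyD : y ∈ Da := by
    by_contra hyD
    obtain ⟨c, -, hc, d, hd, hdD, hcd⟩ := hL.exists_adj_boundary hx hxD hy hyD
    exact hdD (h.closedA c hc d (hout d hd).1 (hout d hd).2 hcd)
  exact h.anti y hyD b hbD hby.symm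

/-- Let `u ∈ C`, and let `a` and `b` be attached to the component of `u` outside the core. A
separation of `a` from `b` lies in the neighbourhood of `u`. -/
theorem IsNCCover.adj_of_isCoreSeparation [Finite V] {C : Set V} (hC : G.IsNCCover C) {u : V}
    (hu : u ∈ C) {H Da Db T : Set V} (h : G.IsCoreSeparation H u Da Db T) {a b : V}
    (ha : a ∈ Da) (hb : b ∈ Db) (haO : ∃ o ∈ G.compIn (G.core H u)ᶜ u, G.Adj o a)
    (hbO : ∃ o ∈ G.compIn (G.core H u)ᶜ u, G.Adj o b) : ∀ t ∈ T, G.Adj u t := by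
  have huO : u ∈ G.compIn (G.core H u)ᶜ u := mem_compIn_self fun h' => h'.1 rfl
  -- The component of `u` outside the core can leave the side `D` only through `u`.
  have key : ∀ D : Set V, u ∉ D → (∀ x ∈ D, ∀ y, y ≠ u → y ∉ T → G.Adj x y → y ∈ D) →
      ∀ x ∈ D, (∃ o ∈ G.compIn (G.core H u)ᶜ u, G.Adj o x) → ∃ d ∈ D, G.Adj u d := by
    rintro D huD hcl x hx ⟨o, ho, hox⟩
    obtain ⟨c, -, hc, d, hd, hdD, hcd⟩ := (setConn_compIn.insert_adj ho hox).exists_adj_boundary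
      (Set.mem_insert x _) hx (Set.mem_insert_of_mem x huO) huD
    rcases hd with rfl | hd
    · exact absurd hx hdD
    · by_cases hdu : d = u
      · exact ⟨c, hc, hdu ▸ hcd.symm⟩
      · exact absurd (hcl c hc d hdu (fun h' => compIn_subset hd (h.subset h')) hcd) hdD
  obtain ⟨p, hp, q, hq, hpq, hadj⟩ := not_isClique_iff_exists.1 h.not_clique
  have huT : ∀ t ∈ T, u ≠ t := fun t ht => (h.subset ht).1.symm
  exact fun t ht => hC.adj_of_twoSided hu (A := Da) (B := Db) (p := p) (q := q)
    ⟨h.connA, h.connB, h.disj, h.anti, h.disjA p hp, h.disjB p hp, h.disjA q hq, h.disjB q hq, hpq,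
      hadj, h.adjA p hp, h.adjB p hp, h.adjA q hq, h.adjB q hq⟩ h.notMemA h.notMemB (huT p hp)
    (huT q hq) (key Da h.notMemA h.closedA a ha haO) (key Db h.notMemB h.closedB b hb hbO)
    (huT t ht) (h.disjA t ht) (h.disjB t ht) (h.adjA t ht) (h.adjB t ht)

/-- In a graph without clique cutsets, a vertex of `C` that avoids some hole is adjacent to the
whole core of that hole. -/
theorem IsNCCover.adj_of_mem_core [Finite V] {C : Set V} (hC : G.IsNCCover C)
    (hcut : ∀ K, G.IsClique K → G.SetConn Kᶜ) {u : V} (hu : u ∈ C) {H : Set V}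
    (hH : G.IsHoleSet H) (huH : u ∉ H) : ∀ x ∈ G.core H u, G.Adj u x := by
  set A := G.core H u with hA
  set O := G.compIn Aᶜ u with hO
  have huA : u ∉ A := fun h => h.1 rfl
  have huO : u ∈ O := mem_compIn_self huA
  have hOA : O ⊆ Aᶜ := compIn_subset
  -- Since the attachments of the component `O` of `u` are no clique cutset, there is a non-clique
  -- `T` in the core all of whose vertices are neighbours of `u`.
  have hB : ¬ G.IsClique (G.att A O) := by
    intro hcl
    obtain ⟨h, hh, hhB⟩ : ∃ h ∈ H, h ∉ G.att A O := by
      by_contra! hcon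
      exact hH.not_isClique (hcl.subset hcon)
    obtain ⟨c, -, hc, d, hd, hdO, hcd⟩ := (hcut _ hcl).exists_adj_boundary (x := u) (y := h)
      (U := O) (fun h' => huA h'.1) huO hhB (fun h' => hOA h' (subset_core huH hh))
    by_cases hdA : d ∈ A
    · exact hd ⟨hdA, c, hc, hcd⟩
    · exact hdO (compIn_closed hc hdA hcd)
  obtain ⟨a, ⟨haA, haO⟩, b, ⟨hbA, hbO⟩, hab, hadj⟩ := not_isClique_iff_exists.1 hB
  obtain ⟨Da, Db, T, hT, haD, hbD⟩ := hH.exists_isCoreSeparation huH haA hbA hab hadj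
  have huT := hC.adj_of_isCoreSeparation hu hT haD hbD haO hbO
  intro y hyA
  by_contra huy
  set Y := G.compIn (A \ {x | G.Adj u x}) y with hY
  have hYs : Y ⊆ A \ {x | G.Adj u x} := compIn_subset
  have hYc : G.SetConn Y := setConn_compIn
  have hyY : y ∈ Y := mem_compIn_self ⟨hyA, huy⟩
  set K := G.att (A ∩ {x | G.Adj u x}) Y with hK
  have hKcl : G.IsClique K := by
    rintro a ⟨⟨haA, hua⟩, z, hz, hza⟩ b ⟨⟨hbA, hub⟩, z', hz', hzb⟩ hab
    by_contra hadj
    obtain ⟨Da, Db, T, hT, haD, hbD⟩ := hH.exists_isCoreSeparation huH haA hbA hab hadj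
    have huT := hC.adj_of_isCoreSeparation hu hT haD hbD ⟨u, huO, hua⟩ ⟨u, huO, hub⟩
    have hout : ∀ c ∈ Y, c ≠ u ∧ c ∉ T := fun c hc =>
      ⟨(hYs hc).1.1, fun h' => (hYs hc).2 (huT c h')⟩
    have hzD : z ∈ Da := hT.closedA a haD z (hout z hz).1 (hout z hz).2 hza.symm
    have hzD' : z' ∈ Da := by
      by_contra hzD'
      obtain ⟨c, -, hc, d, hd, hdD, hcd⟩ := hYc.exists_adj_boundary hz hzD hz' hzD'
      exact hdD (hT.closedA c hc d (hout d hd).1 (hout d hd).2 hcd)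
    exact hT.anti z' hzD' b hbD hzb
  obtain ⟨p, hpT, hpK⟩ : ∃ p ∈ T, p ∉ K := by
    by_contra! hcon
    exact hT.not_clique (hKcl.subset hcon)
  have hpA : p ∈ A := hT.subset hpT
  have hYA : ∀ c ∈ Y, ∀ d ∈ A, d ∉ K → G.Adj c d → d ∈ Y := by
    intro c hc d hdA hdK hcd
    by_cases hud : G.Adj u d
    · exact absurd ⟨⟨hdA, hud⟩, c, hc, hcd⟩ hdK
    · exact compIn_closed hc ⟨hdA, hud⟩ hcd
  -- `Y` and the components outside the core that are attached to `Y` are separated from `p`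
  -- by the clique `K`.
  have hlink := hH.linkedIn_of_mem_core huH hyA hpA hKcl (fun h => huA h.1.1)
    (fun h => huy h.1.2) hpK
  have hp := hlink.mem_of_closed
    (U := Y ∪ {x | x ∉ A ∧ ∃ z, G.LinkedIn (insert u A)ᶜ x z ∧ ∃ c ∈ Y, G.Adj z c}) (Or.inl hyY) (by
      rintro c hc hcs d hds hcd
      have hdu : d ≠ u := fun h => hds (Or.inl h)
      have hdK : d ∉ K := fun h => hds (Or.inr h)
      have hcu : c ≠ u := fun h => hcs (Or.inl h)
      rcases hc with hc | ⟨hcA, z, hcz, y', hy', hzy⟩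
      · by_cases hdA : d ∈ A
        · exact Or.inl (hYA c hc d hdA hdK hcd)
        · exact Or.inr ⟨hdA, d, .refl, c, hc, hcd.symm⟩
      · have hcO : c ∈ (insert u A)ᶜ := fun h => h.elim hcu hcA
        by_cases hdA : d ∈ A
        · by_cases hdy : d = y'
          · exact Or.inl (hdy ▸ hy')
          · refine Or.inl (hYA y' hy' d hdA hdK (hH.adj_of_core huH
              (L := G.compIn (insert u A)ᶜ c) setConn_compIn
              (fun h => compIn_subset h (Or.inl rfl))
              (fun x hx hxA => compIn_subset hx (Or.inr hxA))
              hdA (hYs hy').1 hdy ⟨c, mem_compIn_self hcO, hcd.symm⟩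
              ⟨z, ⟨hcz.mem hcO, hcz⟩, hzy.symm⟩).symm)
        · exact Or.inr ⟨hdA, z, (hcd.symm.linkedIn (fun h => h.elim hdu hdA) hcO).trans hcz,
            y', hy', hzy⟩)
  rcases hp with hp | hp
  · exact (hYs hp).2 (huT p hpT)
  · exact hp.1 hpA

/-- In a graph without clique cutsets, a vertex of `C` that lies on some hole lies on all holes. -/
theorem IsNCCover.mem_of_mem [Finite V] {C : Set V} (hC : G.IsNCCover C)
    (hcut : ∀ K, G.IsClique K → G.SetConn Kᶜ) {u : V} (hu : u ∈ C) {H₀ H : Set V}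
    (hH₀ : G.IsHoleSet H₀) (huH₀ : u ∈ H₀) (hH : G.IsHoleSet H) : u ∈ H := by
  by_contra huH
  have hadj := hC.adj_of_mem_core hcut hu hH huH
  -- A non-neighbour `x` of `u` lies outside the core; its component there is cut off by a clique.
  obtain ⟨x, -, hux, hnadj⟩ := hH₀.exists_not_adj huH₀
  have hxA : x ∉ G.core H u := fun h => hnadj (hadj x h)
  have hxU : x ∈ (insert u (G.core H u))ᶜ := fun h => h.elim (fun h' => hux h'.symm) hxA
  set L := G.compIn (insert u (G.core H u))ᶜ x with hL
  have hLs : L ⊆ (insert u (G.core H u))ᶜ := compIn_subset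
  have hcl : G.IsClique (G.att (G.core H u) L) := by
    rintro a ⟨ha, z, hz, hza⟩ b ⟨hb, z', hz', hzb⟩ hab
    exact hH.adj_of_core huH (L := L) setConn_compIn (fun h => hLs h (Or.inl rfl))
      (fun x hx h => hLs hx (Or.inr h)) ha hb hab ⟨z, hz, hza.symm⟩ ⟨z', hz', hzb.symm⟩
  have hcl' : G.IsClique (insert u (G.att (G.core H u) L)) :=
    hcl.insert fun b hb _ => hadj b hb.1
  obtain ⟨h, hh, hhK⟩ : ∃ h ∈ H, h ∉ G.att (G.core H u) L := by
    by_contra! hcon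
    exact hH.not_isClique (hcl.subset hcon)
  obtain ⟨c, -, hc, d, hd, hdL, hcd⟩ := (hcut _ hcl').exists_adj_boundary (x := x) (y := h)
    (U := L) (fun h => h.elim (fun h' => hux h'.symm) fun h' => hxA h'.1) (mem_compIn_self hxU)
    (fun h' => h'.elim (fun h'' => huH (h'' ▸ hh)) hhK)
    (fun h' => hLs h' (Or.inr (subset_core huH hh)))
  have hdu : d ≠ u := fun h' => hd (Or.inl h')
  by_cases hdA : d ∈ G.core H u
  · exact hd (Or.inr ⟨hdA, c, hc, hcd⟩)
  · exact hdL (compIn_closed hc (fun h' => h'.elim hdu hdA) hcd)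

end CliqueCutsets

section NearSimplicial

universe u

variable {V : Type u} {G : SimpleGraph V}

/-! ### Nearly simplicial vertices -/

/-- The neighbourhood of `v` is a clique, possibly after removing a vertex of `C`. -/
def IsNearSimplicial (G : SimpleGraph V) (C : Set V) (v : V) : Prop :=
  G.IsClique (G.neighborSet v) ∨ ∃ w ∈ C, G.IsClique (G.neighborSet v \ {w})

theorem IsNearSimplicial.of_induce {C s : Set V} {v : s}
    (h : (G.induce s).IsNearSimplicial (Subtype.val ⁻¹' C) v) (hv : G.neighborSet v ⊆ s) :
    G.IsNearSimplicial C v := by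
  rcases h with h | ⟨w, hw, h⟩
  · refine Or.inl fun a ha b hb hab => ?_
    exact h (x := ⟨a, hv ha⟩) ha (y := ⟨b, hv hb⟩) hb fun h' => hab (congrArg Subtype.val h')
  · refine Or.inr ⟨w, hw, fun a ha b hb hab => ?_⟩
    exact h (x := ⟨a, hv ha.1⟩) ⟨ha.1, fun h' => ha.2 (congrArg Subtype.val h')⟩
      (y := ⟨b, hv hb.1⟩) ⟨hb.1, fun h' => hb.2 (congrArg Subtype.val h')⟩
      fun h' => hab (congrArg Subtype.val h')

theorem IsNCCover.induce {C : Set V} (hC : G.IsNCCover C) (t : Set V) :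
    (G.induce t).IsNCCover (Subtype.val ⁻¹' C) where
  cover s hs := by
    obtain ⟨w, hw, x, hx, rfl⟩ := hC.cover _ hs.image_val
    exact ⟨x, hw, hx⟩
  unique s hs x hx hxs y hy hys :=
    Subtype.ext (hC.unique _ hs.image_val x hx ⟨x, hxs, rfl⟩ y hy ⟨y, hys, rfl⟩)
  nc u hu s s' hs hs' hus hus' a b c hac ha hb hc hab hbc :=
    hC.nc u hu _ _ hs.image_val hs'.image_val ⟨u, hus, rfl⟩
      (by rintro ⟨x, hx, hxu⟩; exact hus' (Subtype.ext hxu ▸ hx)) a b c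
      (fun h => hac (Subtype.ext h)) ⟨⟨a, ha.1, rfl⟩, ⟨a, ha.2, rfl⟩⟩
      ⟨⟨b, hb.1, rfl⟩, ⟨b, hb.2, rfl⟩⟩ ⟨⟨c, hc.1, rfl⟩, ⟨c, hc.2, rfl⟩⟩ hab hbc

/-- A chordal graph without clique cutsets is complete. -/
theorem adj_of_forall_not_isHoleSet (hcut : ∀ K, G.IsClique K → G.SetConn Kᶜ)
    (hno : ∀ s, ¬ G.IsHoleSet s) {a b : V} (hab : a ≠ b) : G.Adj a b := by
  by_contra hadj
  set S : Set V := {x | x ≠ a ∧ ¬ G.Adj a x} with hS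
  set D := G.compIn S b with hD
  have hDS : D ⊆ S := compIn_subset
  have hDc : G.SetConn D := setConn_compIn
  have hbD : b ∈ D := mem_compIn_self ⟨hab.symm, hadj⟩
  have haD : a ∉ D := fun h => (hDS h).1 rfl
  have hT : ∀ t, t ∉ D → (∃ d ∈ D, G.Adj t d) → G.Adj a t := by
    rintro t htD ⟨d, hd, htd⟩
    by_contra hat
    refine htD (compIn_closed hd ⟨?_, hat⟩ htd.symm)
    rintro rfl
    exact (hDS hd).2 htd
  have hnc : ¬ G.IsClique {t | t ∉ D ∧ ∃ d ∈ D, G.Adj t d} := by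
    intro hcl
    obtain ⟨c, -, hc, d, hd, hdD, hcd⟩ := (hcut _ hcl).exists_adj_boundary (x := b) (y := a)
      (U := D) (fun h => h.1 hbD) hbD (fun h => (hT a haD h.2).ne rfl) haD
    exact hd ⟨hdD, c, hc, hcd.symm⟩
  obtain ⟨p, ⟨hpD, hp⟩, q, ⟨hqD, hq⟩, hpq, hadj'⟩ := not_isClique_iff_exists.1 hnc
  have hap := hT p hpD hp
  have haq := hT q hqD hq
  obtain ⟨X₀, -, Y₀, -, -, -, -, -, -, -, hole⟩ := exists_isHoleSet (p := p) (q := q)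
    (setConn_singleton a) hDc (by simpa using haD)
    (fun x hx y hy hxy => (hDS hy).2 (by rwa [Set.mem_singleton_iff.1 hx] at hxy))
    (fun h => hap.ne h.symm) (fun h => haq.ne h.symm) hpD hqD hpq hadj' ⟨a, rfl, hap.symm⟩
    ⟨a, rfl, haq.symm⟩ hp hq
  exact hno _ hole

/-- An analogue of Dirac's theorem on simplicial vertices of chordal graphs: if `G` is not complete,
it has two nonadjacent nearly simplicial vertices. The proof is by induction on the number `n` of
vertices. A clique cutset leaves such a vertex on each of its two sides; in the absence of clique
cutsets, the vertex of `C` common to all holes is deleted. The induction ranges over all sets `C`,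
as the empty set is used for the remaining chordal graph. -/
theorem IsNCCover.exists_isNearSimplicial_aux (n : ℕ) : ∀ (V : Type u) [Finite V]
    (G : SimpleGraph V) (C : Set V), Nat.card V = n → G.IsNCCover C →
    (∀ x y, x ≠ y → G.Adj x y) ∨ ∃ v₁ v₂, v₁ ≠ v₂ ∧ ¬ G.Adj v₁ v₂ ∧
      G.IsNearSimplicial C v₁ ∧ G.IsNearSimplicial C v₂ := by
  induction n using Nat.strong_induction_on with
  | _ n ih =>
  intro V _ G C hn hC
  have ih' : ∀ (s : Set V) (C' : Set s), s ≠ Set.univ → (G.induce s).IsNCCover C' →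
      (∀ x y : s, x ≠ y → G.Adj x y) ∨ ∃ v₁ v₂ : s, v₁ ≠ v₂ ∧ ¬ G.Adj v₁ v₂ ∧
        (G.induce s).IsNearSimplicial C' v₁ ∧ (G.induce s).IsNearSimplicial C' v₂ := by
    intro s C' hs hC'
    refine ih (Nat.card s) ?_ s (G.induce s) C' rfl hC'
    rw [← hn, Nat.card_coe_set_eq, ← Set.ncard_univ]
    exact Set.ncard_lt_ncard (s.subset_univ.ssubset_of_ne hs) (Set.toFinite _)
  by_cases hcut : ∀ K, G.IsClique K → G.SetConn Kᶜ
  · by_cases hno : ∀ s, ¬ G.IsHoleSet s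
    · exact Or.inl fun x y hxy => adj_of_forall_not_isHoleSet hcut hno hxy
    · push Not at hno
      obtain ⟨s, hs⟩ := hno
      obtain ⟨w, hwC, hws⟩ := hC.cover s hs
      -- All holes contain `w`, so that `G - w` is chordal.
      have hcov : (G.induce {w}ᶜ).IsNCCover ∅ := by
        have hno : ∀ t, ¬ (G.induce {w}ᶜ).IsHoleSet t := by
          intro t ht
          obtain ⟨x, -, hx⟩ := hC.mem_of_mem hcut hwC hs hws ht.image_val
          exact x.2 hx
        exact ⟨fun t ht => absurd ht (hno t), fun t ht => absurd ht (hno t), fun u hu => hu.elim⟩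
      have hnear : ∀ v : ({w}ᶜ : Set V), (G.induce {w}ᶜ).IsNearSimplicial ∅ v →
          G.IsNearSimplicial C v := by
        rintro v (h | ⟨_, h, -⟩)
        · refine Or.inr ⟨w, hwC, fun a ha b hb hab => ?_⟩
          exact h (x := ⟨a, ha.2⟩) ha.1 (y := ⟨b, hb.2⟩) hb.1
            fun h' => hab (congrArg Subtype.val h')
        · exact h.elim
      rcases ih' {w}ᶜ ∅ (by simp) hcov with hcomp | ⟨v₁, v₂, hne, hadj, h₁, h₂⟩
      · exfalso
        obtain ⟨y, hys, hwy, -⟩ := hs.exists_not_adj hws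
        obtain ⟨a, -, rfl, x, ⟨hxs, -⟩, hxw, hwx⟩ :=
          (hs.setConn_diff (K := ∅) (by simp)).exists_adj_boundary (x := w) (y := y)
            (U := {w}) ⟨hws, id⟩ rfl ⟨hys, id⟩ hwy.symm
        obtain ⟨x', hx's, hxx', hnadj⟩ := hs.exists_not_adj hxs
        exact hnadj (hcomp ⟨x, hxw⟩ ⟨x', fun h => hnadj
          ((Set.mem_singleton_iff.1 h).symm ▸ hwx.symm)⟩ fun h => hxx' (congrArg Subtype.val h))
      · exact Or.inr ⟨v₁, v₂, fun h => hne (Subtype.ext h), hadj, hnear v₁ h₁, hnear v₂ h₂⟩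
  · push Not at hcut
    obtain ⟨K, hK, hKc⟩ := hcut
    simp only [SetConn, not_forall] at hKc
    obtain ⟨x, hx, y, hy, hxy⟩ := hKc
    -- Two nonadjacent vertices of the induced subgraph on a side cannot both lie in `K`.
    have side : ∀ (s : Set V) (r : V), s ≠ Set.univ → r ∈ s → r ∉ K →
        (∀ v ∈ s, v ∉ K → G.neighborSet v ⊆ s) → ∃ v ∈ s, v ∉ K ∧ G.IsNearSimplicial C v := by
      intro s r hs hr hrK hnb
      rcases ih' s _ hs (hC.induce s) with hcomp | ⟨v₁, v₂, hne, hadj, h₁, h₂⟩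
      · refine ⟨r, hr, hrK, Or.inl fun a ha b hb hab => ?_⟩
        exact hcomp ⟨a, hnb r hr hrK ha⟩ ⟨b, hnb r hr hrK hb⟩ fun h => hab (congrArg Subtype.val h)
      · by_cases hv₁ : (v₁ : V) ∈ K
        · have hv₂ : (v₂ : V) ∉ K := fun h => hadj (hK hv₁ h fun h' => hne (Subtype.ext h'))
          exact ⟨v₂, v₂.2, hv₂, h₂.of_induce (hnb v₂ v₂.2 hv₂)⟩
        · exact ⟨v₁, v₁.2, hv₁, h₁.of_induce (hnb v₁ v₁.2 hv₁)⟩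
    set L := G.compIn Kᶜ x with hL
    have hxL : x ∈ L := mem_compIn_self hx
    have hyL : y ∉ L := fun h => hxy h.2
    obtain ⟨v₁, hv₁, hv₁K, h₁⟩ := side (L ∪ K) x
      (fun h => (h ▸ Set.mem_univ y : y ∈ L ∪ K).elim hyL hy) (Or.inl hxL) hx (by
        rintro v (hv | hv) hvK z hvz
        · by_cases hz : z ∈ K
          · exact Or.inr hz
          · exact Or.inl (compIn_closed hv hz hvz)
        · exact absurd hv hvK)
    obtain ⟨v₂, hv₂, hv₂K, h₂⟩ := side Lᶜ y
      (fun h => (h ▸ Set.mem_univ x : x ∈ Lᶜ) hxL) hyL hy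
      (fun v hv hvK z hvz hz => hv (compIn_closed hz hvK (show G.Adj v z from hvz).symm))
    have hv₁L : v₁ ∈ L := hv₁.resolve_right hv₁K
    exact Or.inr ⟨v₁, v₂, fun h => hv₂ (h ▸ hv₁L), fun h => hv₂ (compIn_closed hv₁L hv₂K h), h₁, h₂⟩

theorem IsNCCover.exists_isClique_neighborSet_diff [Finite V] [Nonempty V] {C : Set V}
    (hC : G.IsNCCover C) : ∃ v w, G.IsClique (G.neighborSet v \ {w}) := by
  rcases exists_isNearSimplicial_aux _ V G C rfl hC with h | ⟨v, -, -, -, h | ⟨w, -, h⟩, -⟩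
  · obtain ⟨v⟩ := ‹Nonempty V›
    exact ⟨v, v, fun a _ b _ hab => h a b hab⟩
  · exact ⟨v, v, h.subset Set.sdiff_subset⟩
  · exact ⟨v, w, h⟩

/-- If all cliques inside `s` have fewer than `k` vertices, then some vertex of `s` has fewer than
`k` neighbours in `s`. -/
theorem IsNCCover.exists_ncard_lt [Finite V] {C : Set V} (hC : G.IsNCCover C) {s : Set V}
    (hs : s.Nonempty) {k : ℕ} (hk : ∀ K ⊆ s, G.IsClique K → K.ncard < k) :
    ∃ v ∈ s, {y ∈ s | G.Adj v y}.ncard < k := by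
  have := hs.to_subtype
  obtain ⟨v, w, h⟩ := (hC.induce s).exists_isClique_neighborSet_diff
  have hcl : G.IsClique (insert (v : V) ({y ∈ s | G.Adj v y} \ {(w : V)})) := by
    refine IsClique.insert (fun a ha b hb hab => ?_) fun b hb _ => hb.1.2
    exact h (x := ⟨a, ha.1.1⟩) ⟨ha.1.2, fun h' => ha.2 (congrArg Subtype.val h')⟩
      (y := ⟨b, hb.1.1⟩) ⟨hb.1.2, fun h' => hb.2 (congrArg Subtype.val h')⟩
      fun h' => hab (congrArg Subtype.val h')
  have hlt := hk _ (Set.insert_subset v.2 fun y hy => hy.1.1) hcl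
  rw [Set.ncard_insert_of_notMem (fun h => h.1.2.ne rfl) (Set.toFinite _)] at hlt
  -- The clique contains `v` in addition to its neighbours, which makes up for the loss of `w`.
  refine ⟨v, v.2, lt_of_le_of_lt ?_ hlt⟩
  calc {y ∈ s | G.Adj v y}.ncard
      ≤ (insert (w : V) ({y ∈ s | G.Adj v y} \ {(w : V)})).ncard :=
        Set.ncard_le_ncard (by rw [Set.insert_sdiff_singleton]; exact Set.subset_insert _ _)
          (Set.toFinite _)
    _ ≤ _ := Set.ncard_insert_le _ _

end NearSimplicial

section DPColoring

variable {V : Type*} {G : SimpleGraph V}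

/-! ### DP-colouring -/

theorem DPColorable.colorable {k : ℕ} (h : G.DPColorable k) : G.Colorable k := by
  obtain ⟨f, hf⟩ := h ⟨fun _ _ a b => a = b, fun _ _ _ _ _ h => h.symm,
    fun _ _ _ _ _ _ h h' => h.symm.trans h'⟩
  exact ⟨Coloring.mk f fun {u v} huv => hf u v huv⟩

/-- A graph is DP-`k`-colourable by a greedy colouring if every nonempty set of vertices induces a
subgraph with a vertex of degree less than `k`. -/
theorem dpColorable_of_forall_exists_ncard_lt [Finite V] {k : ℕ} (hk : 0 < k)
    (h : ∀ s : Set V, s.Nonempty → ∃ v ∈ s, {y ∈ s | G.Adj v y}.ncard < k) :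
    G.DPColorable k := by
  intro M
  suffices key : ∀ n, ∀ s : Set V, s.ncard = n →
      ∃ f : V → Fin k, ∀ u ∈ s, ∀ v ∈ s, G.Adj u v → ¬ M.rel u v (f u) (f v) by
    obtain ⟨f, hf⟩ := key _ Set.univ rfl
    exact ⟨f, fun u v => hf u (Set.mem_univ u) v (Set.mem_univ v)⟩
  intro n
  induction n with
  | zero =>
    intro s hs
    rw [Set.ncard_eq_zero] at hs
    exact ⟨fun _ => ⟨0, hk⟩, fun u hu => by simp [hs] at hu⟩
  | succ n ih =>
    intro s hs
    obtain ⟨v, hv, hlt⟩ := h s (Set.nonempty_of_ncard_ne_zero (by omega))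
    obtain ⟨f, hf⟩ := ih (s \ {v}) (by rw [Set.ncard_sdiff_singleton_of_mem hv, hs]; rfl)
    -- Each neighbour of `v` in `s` excludes at most one colour at `v`.
    obtain ⟨c, hc⟩ : ∃ c, ∀ y ∈ s, G.Adj v y → ¬ M.rel y v (f y) c := by
      by_contra! hcon
      choose g hg hvg hrel using hcon
      have hinj : Function.Injective g := fun c c' hcc => by
        have h' := hrel c'
        rw [← hcc] at h'
        exact M.unique _ _ (hvg c).symm _ _ _ (hrel c) h'
      have hle : (Set.range g).ncard ≤ {y ∈ s | G.Adj v y}.ncard :=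
        Set.ncard_le_ncard (by rintro _ ⟨c, rfl⟩; exact ⟨hg c, hvg c⟩) (Set.toFinite _)
      rw [← Set.image_univ, Set.ncard_image_of_injective _ hinj, Set.ncard_univ,
        Nat.card_fin] at hle
      omega
    classical
    refine ⟨Function.update f v c, fun x hx y hy hxy => ?_⟩
    by_cases hxv : x = v
    · subst hxv
      rw [Function.update_self, Function.update_of_ne hxy.ne']
      exact fun h' => hc y hy hxy (M.symm _ _ hxy _ _ h')
    · by_cases hyv : y = v
      · subst hyv
        rw [Function.update_self, Function.update_of_ne hxv]
        exact hc x hx hxy.symm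
      · rw [Function.update_of_ne hxv, Function.update_of_ne hyv]
        exact hf x ⟨hx, hxv⟩ y ⟨hy, hyv⟩ hxy

end DPColoring

section CliqueDecomposition

variable {V : Type*} {G : SimpleGraph V}

/-! ### Edge-disjoint unions of cliques -/

/-- The edges of `G` are partitioned into `k` cliques `S i` with `k` vertices each, which cover
all vertices. -/
structure IsCliqueDecomposition (G : SimpleGraph V) {k : ℕ} (S : Fin k → Set V) : Prop where
  isClique : ∀ i, G.IsClique (S i)
  ncard : ∀ i, (S i).ncard = k
  inter : ∀ i j, i ≠ j → ∀ x ∈ S i, x ∈ S j → ∀ y ∈ S i, y ∈ S j → x = y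
  adj : ∀ x y, G.Adj x y → ∃ i, x ∈ S i ∧ y ∈ S i
  cover : ∀ x, ∃ i, x ∈ S i

/-- A part of the decomposition has fewer than `k` vertices that lie on a further part. -/
theorem IsCliqueDecomposition.ncard_lt {k : ℕ} {S : Fin k → Set V}
    (h : G.IsCliqueDecomposition S) {i : Fin k} {K : Set V} (hKi : K ⊆ S i)
    (hK : ∀ x ∈ K, ∃ i j, i ≠ j ∧ x ∈ S i ∧ x ∈ S j) : K.ncard < k := by
  -- Distinct vertices of `K` lie on distinct parts other than `S i`.
  have hne : ∀ x : K, ∃ j, j ≠ i ∧ (x : V) ∈ S j := by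
    rintro ⟨x, hx⟩
    obtain ⟨j, j', hj, hxj, hxj'⟩ := hK x hx
    by_cases hji : j = i
    · exact ⟨j', fun h' => hj (hji.trans h'.symm), hxj'⟩
    · exact ⟨j, hji, hxj⟩
  choose g hg hgS using hne
  have hinj : Function.Injective g := fun x y hxy =>
    Subtype.ext (h.inter i (g x) (hg x).symm x (hKi x.2) (hgS x) y (hKi y.2) (hxy ▸ hgS y))
  have hle := Nat.card_le_card_of_injective (fun x => (⟨g x, hg x⟩ : {j : Fin k // j ≠ i}))
    fun x y hxy => hinj (congrArg Subtype.val hxy)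
  rw [Nat.card_coe_set_eq, Nat.card_eq_fintype_card, Fintype.card_subtype_compl,
    Fintype.card_fin, Fintype.card_subtype_eq] at hle
  have := i.2
  omega

/-- A clique on `k` vertices that lie on at least two parts each contains all such vertices. With
the parts as lines it is a configuration with as many points as lines in which any two points are
on a line, so that any two lines meet in one of its points. -/
theorem IsCliqueDecomposition.mem_of_isClique {k : ℕ} {S : Fin k → Set V}
    (h : G.IsCliqueDecomposition S) {K : Set V} (hcl : G.IsClique K) (hKk : K.ncard = k)
    (hK : ∀ x ∈ K, ∃ i j, i ≠ j ∧ x ∈ S i ∧ x ∈ S j) {v : V} {i j : Fin k} (hij : i ≠ j)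
    (hvi : v ∈ S i) (hvj : v ∈ S j) : v ∈ K := by
  have hfin : K.Finite := Set.finite_of_ncard_ne_zero (by have := i.2; omega)
  have := hfin.fintype
  let _ : Membership K (Fin k) := ⟨fun i x => (x : V) ∈ S i⟩
  have hline : ∀ {x y : K}, x ≠ y → ∃ i, (x : V) ∈ S i ∧ (y : V) ∈ S i := fun {x y} hxy =>
    h.adj x y (hcl x.2 y.2 fun h' => hxy (Subtype.ext h'))
  let _ : Configuration.HasLines K (Fin k) :=
    { exists_point := fun l => by
        by_contra! hcon
        exact (h.ncard_lt (fun x hx => hcon ⟨x, hx⟩) hK).ne hKk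
      exists_line := fun p => by
        by_contra! hcon
        have h1 : 1 < K.ncard := by
          have := i.2
          have := j.2
          have : i.val ≠ j.val := fun h' => hij (Fin.ext h')
          omega
        obtain ⟨q, hq, hqp⟩ := Set.exists_ne_of_one_lt_ncard h1 (p : V)
        obtain ⟨l, l', hl, hql, hql'⟩ := hK q hq
        exact hqp (h.inter l l' hl q hql hql' p (hcon l) (hcon l'))
      eq_or_eq := fun {p q l l'} hpl hql hpl' hql' => by
        by_cases hl : l = l'
        · exact Or.inr hl
        · exact Or.inl (Subtype.ext (h.inter l l' hl p hpl hpl' q hql hql'))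
      mkLine := fun {x y} hxy => (hline hxy).choose
      mkLine_ax := fun {x y} hxy => (hline hxy).choose_spec }
  have hcard : Fintype.card K = Fintype.card (Fin k) := by
    rw [← Nat.card_eq_fintype_card, Nat.card_coe_set_eq, hKk, Fintype.card_fin]
  let _ := Configuration.HasLines.hasPoints (P := K) (L := Fin k) hcard
  obtain ⟨hpi, hpj⟩ := Configuration.HasPoints.mkPoint_ax (P := K) hij
  rw [h.inter i j hij v hvi hvj _ hpi hpj]
  exact Subtype.prop _

/-- The condition for the greedy colouring. It is clear at a vertex on a single part; otherwise
either all cliques inside `s` are small, or `s` is itself a clique on `k` vertices. -/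
theorem IsCliqueDecomposition.exists_ncard_lt [Finite V] {k : ℕ} {S : Fin k → Set V}
    (h : G.IsCliqueDecomposition S) {C : Set V} (hC : G.IsNCCover C) {s : Set V}
    (hs : s.Nonempty) : ∃ v ∈ s, {y ∈ s | G.Adj v y}.ncard < k := by
  by_cases hs2 : ∀ v ∈ s, ∃ i j, i ≠ j ∧ v ∈ S i ∧ v ∈ S j
  · by_cases hcl : ∀ K ⊆ s, G.IsClique K → K.ncard < k
    · exact hC.exists_ncard_lt hs hcl
    · push Not at hcl
      obtain ⟨K, hKs, hK, hkK⟩ := hcl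
      obtain ⟨K', hK'K, hK'⟩ := Set.exists_subset_card_eq hkK
      have hsK : s ⊆ K' := fun v hv => by
        obtain ⟨i, j, hij, hi, hj⟩ := hs2 v hv
        exact h.mem_of_isClique (hK.subset hK'K) hK' (fun x hx => hs2 x (hKs (hK'K hx))) hij hi hj
      obtain ⟨v, hv⟩ := hs
      refine ⟨v, hv, hK' ▸ Set.ncard_lt_ncard (t := K') ⟨fun y hy => hsK hy.1, fun h' => ?_⟩
        (Set.toFinite _)⟩
      exact (h' (hsK hv)).2.ne rfl
  · push Not at hs2
    obtain ⟨v, hv, hv1⟩ := hs2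
    obtain ⟨i, hi⟩ := h.cover v
    refine ⟨v, hv, h.ncard i ▸ Set.ncard_lt_ncard (t := S i) ⟨fun y hy => ?_, fun h' => ?_⟩
      (Set.toFinite _)⟩
    · obtain ⟨j, hvj, hyj⟩ := h.adj v y hy.2
      by_cases hij : i = j
      · exact hij ▸ hyj
      · exact absurd hvj (hv1 i j hij hi)
    · exact (h' hi).2.ne rfl

theorem isCliqueDecomposition_of_iSup_eq_top {k : ℕ} (L : Fin k → G.Subgraph)
    (hcopy : ∀ i, Nonempty ((L i).coe ≃g completeGraph (Fin k)))
    (hdisj : ∀ i j, i ≠ j → Disjoint (L i).edgeSet (L j).edgeSet) (hunion : ⨆ i, L i = ⊤) :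
    G.IsCliqueDecomposition fun i => (L i).verts := by
  have hadj : ∀ i, ∀ x ∈ (L i).verts, ∀ y ∈ (L i).verts, x ≠ y → (L i).Adj x y := by
    intro i x hx y hy hxy
    obtain ⟨e⟩ := hcopy i
    have : (L i).coe.Adj ⟨x, hx⟩ ⟨y, hy⟩ := by
      rw [← e.map_adj_iff]
      exact fun h => hxy (congrArg Subtype.val (e.injective h))
    exact this
  refine ⟨fun i x hx y hy hxy => (hadj i x hx y hy hxy).adj_sub, fun i => ?_,
    fun i j hij x hxi hxj y hyi hyj => ?_, fun x y hxy => ?_, fun x => ?_⟩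
  · obtain ⟨e⟩ := hcopy i
    rw [← Nat.card_coe_set_eq, Nat.card_congr e.toEquiv, Nat.card_fin]
  · by_contra hxy
    exact Set.disjoint_left.1 (hdisj i j hij)
      (Subgraph.mem_edgeSet.2 (hadj i x hxi y hyi hxy))
      (Subgraph.mem_edgeSet.2 (hadj j x hxj y hyj hxy))
  · have : (⨆ i, L i).Adj x y := by rw [hunion]; exact hxy
    obtain ⟨i, hi⟩ := Subgraph.iSup_adj.1 this
    exact ⟨i, hi.fst_mem, hi.snd_mem⟩
  · have : x ∈ (⨆ i, L i).verts := by rw [hunion]; trivial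
    rwa [Subgraph.verts_iSup, Set.mem_iUnion] at this

theorem HasNC.exists_isNCCover (h : G.HasNC) : ∃ C, G.IsNCCover C := by
  obtain ⟨C, ⟨-, hcov⟩, hnc, huniq⟩ := h
  refine ⟨C, fun s hs => ?_, fun s hs x hx hxs y hy hys => huniq _ hs.isHole ⟨hxs, hx⟩ ⟨hys, hy⟩,
    fun u hu s s' hs hs' hus hus' a b c hac ha hb hc hab hbc => ?_⟩
  · obtain ⟨w, hws, hwC⟩ := hcov _ hs.isHole
    exact ⟨w, hwC, hws⟩
  · exact hnc u hu _ _ hs.isHole hs'.isHole hus hus' ⟨a, b, c, hac, ⟨ha.1, hb.1, hab⟩,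
      ⟨hb.1, hc.1, hbc⟩, ⟨ha.2, hb.2, hab⟩, ⟨hb.2, hc.2, hbc⟩⟩

end CliqueDecomposition

end SimpleGraph

theorem mainTheorem4 {V : Type*} (G : SimpleGraph V) (hG : G.HasNC)
    (k : ℕ) (hk : 0 < k) (L : Fin k → G.Subgraph)
    (hcopy : ∀ i : Fin k, Nonempty ((L i).coe ≃g SimpleGraph.completeGraph (Fin k)))
    (hdisj : ∀ i j : Fin k, i ≠ j → Disjoint (L i).edgeSet (L j).edgeSet)
    (hunion : ⨆ i : Fin k, L i = ⊤) :
    G.dpChromaticNumber = (k : ℕ∞) ∧ G.chromaticNumber = (k : ℕ∞) := by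
  have h := SimpleGraph.isCliqueDecomposition_of_iSup_eq_top L hcopy hdisj hunion
  -- An infinite set has `ncard` zero.
  have hfin : ∀ i, (L i).verts.Finite := fun i =>
    Set.finite_of_ncard_ne_zero (by rw [h.ncard i]; exact hk.ne')
  have : Finite V := Set.finite_univ_iff.1 ((Set.finite_iUnion hfin).subset fun x _ =>
    Set.mem_iUnion.2 (h.cover x))
  obtain ⟨C, hC⟩ := hG.exists_isNCCover
  have hcol : G.DPColorable k := SimpleGraph.dpColorable_of_forall_exists_ncard_lt hk
    fun s hs => h.exists_ncard_lt hC hs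
  have hlow : ∀ n, G.Colorable n → k ≤ n := fun n hn => by
    have := SimpleGraph.IsClique.card_le_of_colorable (s := (hfin ⟨0, hk⟩).toFinset)
      (by simpa using h.isClique ⟨0, hk⟩) hn
    rwa [← Set.ncard_eq_toFinset_card _ (hfin _), h.ncard] at this
  constructor
  · exact le_antisymm (iInf₂_le k hcol)
      (le_iInf₂ fun n hn => by exact_mod_cast hlow n (SimpleGraph.DPColorable.colorable hn))
  · exact le_antisymm hcol.colorable.chromaticNumber_le
      (le_iInf₂ fun n hn => by exact_mod_cast hlow n hn)
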